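/- Theorem (Optimal two-sided approximation). Let $\lambda>0$, let $G_\lambda(z)=e^{-\pi\lambda z^2}$ for $z\in\mathbb{C}$, and let $G^+_\lambda(x)=x_+^0\,e^{-\pi\lambda x^2}$ for $x\in\mathbb{R}$, where $x_+^0=\frac12(1+\mathrm{sgn}(x))$ (so $x_+^0$ is $0$, $\frac12$, $1$ for $x<0$, $x=0$, $x>0$). An entire function $K:\mathbb{C}\to\mathbb{C}$ is of exponential type at most $\sigma$ if for every $\varepsilon>0$ there is $C_\varepsilon>0$ with $|K(z)|\le C_\varepsilon e^{(\sigma+\varepsilon)|z|}$ for all $z\in\mathbb{C}$. For $\Im\tau>0$ let $$\theta_1(z,\tau)=\sum_{n=-\infty}^{\infty}e^{\pi i\tau(n+\frac12)^2}e^{(2n+1)\pi i z}.$$ The function $$K^+_\lambda(z)=\frac{\sin\pi z}{\pi}\sum_{n=1}^\infty(-1)^n\left\{\frac{G_\lambda(n)}{z-n}-\frac{G_\lambda(n)}{z}\right\},\qquad z\in\mathbb{C}\setminus\{0,1,2,\dots\},$$ extends (across removable singularities) to an entire function of exponential type at most $\pi$, again denoted $K^+_\lambda$, which is real on $\mathbb{R}$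 and satisfies $K^+_\lambda(n)=G^+_\lambda(n)$ for all $n\in\mathbb{Z}\setminus\{0\}$, and $$\sin(\pi x)\,\bigl\{G^+_\lambda(x)-K^+_\lambda(x)\bigr\}\ge 0\qquad\text{for all real }x.$$ Moreover, the function $y\mapsto\theta_1\bigl(0,i\lambda^{-1}(1-y^2)\bigr)$ is integrable on $(0,1)$, and every entire function $K$ of exponential type at most $\pi$ satisfies $$\int_{-\infty}^\infty\bigl|G^+_\lambda(x)-K(x)\bigr|\,dx\ \ge\ \frac1{\pi\lambda}\int_0^1\theta_1\bigl(0,i\lambda^{-1}(1-y^2)\bigr)\,dy$$ (where the left-hand side may be $+\infty$), with equality if and only if $K=K^+_\lambda$. -/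

import Mathlib

open MeasureTheory Filter Topology

noncomputable section

/-- `K : ℂ → ℂ` is an entire function of exponential type at most `σ`: it is holomorphic on `ℂ`
and for every `ε > 0` there is `C > 0` with `|K z| ≤ C * exp ((σ + ε) |z|)` for all `z`. -/
structure IsExpTypeAtMost (σ : ℝ) (K : ℂ → ℂ) : Prop where
  entire : Differentiable ℂ K
  growth : ∀ ε : ℝ, 0 < ε → ∃ C : ℝ, 0 < C ∧ ∀ z : ℂ, ‖K z‖ ≤ C * Real.exp ((σ + ε) * ‖z‖)

/-- The Gaussian `G_lam(z) = exp (-π lam z^2)` on the complex plane. -/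
def gaussianC (lam : ℝ) (z : ℂ) : ℂ :=
  Complex.exp (-(Real.pi : ℂ) * (lam : ℂ) * z ^ 2)

/-- The truncation `x_+^0 = (1 + sgn x) / 2`, equal to `0`, `1/2`, `1` for `x < 0`, `x = 0`,
`x > 0`. -/
def truncZero (x : ℝ) : ℝ := (1 + Real.sign x) / 2

/-- The truncated Gaussian `x_+^0 exp (-π lam x^2)` on the real line. -/
def truncGaussian (lam : ℝ) (x : ℝ) : ℝ :=
  truncZero x * Real.exp (-Real.pi * lam * x ^ 2)

/-- The Jacobi theta function
`θ₁(z, τ) = ∑_{n ∈ ℤ} q^((n + 1/2)^2) e^((2n+1) π i z)` with `q = e^(π i τ)`, for `Im τ > 0`. -/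
def thetaOne (z τ : ℂ) : ℂ :=
  ∑' n : ℤ, Complex.exp ((Real.pi : ℂ) * Complex.I * τ * ((n : ℂ) + 1 / 2) ^ 2) *
    Complex.exp ((2 * (n : ℂ) + 1) * (Real.pi : ℂ) * Complex.I * z)

/-- The interpolation series
`(sin π z / π) ∑_{n ≥ 1} (-1)^n (G_lam(n) / (z - n) - G_lam(n) / z)`,
meaningful for `z ∉ {0, 1, 2, …}`; the summation index is shifted by one. -/
def interpolationSeries (lam : ℝ) (z : ℂ) : ℂ :=
  Complex.sin ((Real.pi : ℂ) * z) / (Real.pi : ℂ) *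
    ∑' n : ℕ, (-1 : ℂ) ^ (n + 1) *
      (gaussianC lam ((n : ℂ) + 1) / (z - ((n : ℂ) + 1)) - gaussianC lam ((n : ℂ) + 1) / z)

/-- The interpolant `K⁺_lam`: the extension of the interpolation series across its removable
singularities `0, 1, 2, …`, its value at `z` being the limit of the series at the punctured
neighbourhoods of `z`. -/
def interpolant (lam : ℝ) (z : ℂ) : ℂ :=
  limUnder (𝓝[≠] z) (interpolationSeries lam)

/-- The point `i lam⁻¹ (1 - y^2)` at which the theta function is evaluated. -/
def thetaPoint (lam y : ℝ) : ℂ := Complex.I * ((lam⁻¹ * (1 - y ^ 2) : ℝ) : ℂ)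

/-- The number `(1 / (π lam)) ∫_0^1 θ₁(0, i lam⁻¹ (1 - y^2)) dy`. On `0 ≤ y < 1` every term of the
theta series is real, so taking the real part changes nothing. -/
def minimalValue (lam : ℝ) : ℝ :=
  1 / (Real.pi * lam) * ∫ y in (0 : ℝ)..1, (thetaOne 0 (thetaPoint lam y)).re

end

/-! The bound is an `L¹` duality argument with `sgn (sin πx)`. As a Fourier series this function has
only the frequencies `(2k+1)π`, and the Fourier transform of an integrable function of exponential
type `π` vanishes at `|a| ≥ π`, so the two are orthogonal
(`IsExpTypeAtMost.integral_sign_sin_smul_eq_zero`). Hence for integrable `K`, `∫ |G⁺ - K| ≥ ∫ sgn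
(sin πx) Re (G⁺ - K) = ∫ sgn (sin πx) G⁺`. Summing the sine transforms of the half-line Gaussian
gives the theta integral (`integral_sign_sin_mul_truncGaussian`). If `K` is not integrable on `ℝ`,
the left side is infinite.

Equality for `K⁺` is exactly the sign property `sin_mul_sub_interpolant_nonneg`. Its source is the
fact that the theta function `∑ exp (-πμn²) cos (2πnc)` is smallest at `c = 1/2`. Write `m = n + 1`.
For `x < 0` the claim is `∑ (-1)^n exp (-πλm²) m/(t+m) ≥ 0` with `t = -x`. A Laplace representation
of `m/(t+m)` reduces it to an inequality on `[-1, 0]` for the power series with coefficients `exp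
(-πλm²)`, which the minimum principle on the unit disc deduces from its boundary case. For `x > 0`
the identity `m/(x-m) = 2m²/(x²-m²) + m/(x+m)` leaves one new sum. After multiplication by `exp
(πμx²)`, together with the cosecant term, it is monotone in `μ`, because the second derivative of
theta at its minimum is nonnegative; its behaviour as `μ → 0⁺` is controlled by the partial
fractions of the cosecant.

Conversely, equality forces `G⁺ - K` to have the sign of `sin πx`, and by continuity `K` agrees with
`G⁺` at every nonzero integer. Then `K - K⁺` is integrable, of type `π` and zero at the nonzero
integers, so it vanishes (`IsExpTypeAtMost.eq_zero_of_intCast`). -/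

noncomputable section

/-! ### The periodized Gaussian and its minimum at the half-integers. -/

/-- The periodized Gaussian `∑ k, exp (-π s (k + c)^2)`. -/
def periodizedGaussian (s c : ℝ) : ℝ :=
  ∑' k : ℤ, Real.exp (-Real.pi * s * (k + c) ^ 2)

lemma summable_periodizedGaussian {s : ℝ} (hs : 0 < s) (c : ℝ) :
    Summable fun k : ℤ => Real.exp (-Real.pi * s * (k + c) ^ 2) := by
  refine (HurwitzKernelBounds.summable_f_int 0 c hs).congr fun k => ?_
  simp [HurwitzKernelBounds.f_int]
  ring_nf

lemma periodizedGaussian_pos {s : ℝ} (hs : 0 < s) (c : ℝ) : 0 < periodizedGaussian s c :=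
  (summable_periodizedGaussian hs c).tsum_pos (fun _ => (Real.exp_pos _).le) 0 (Real.exp_pos _)

lemma periodizedGaussian_add_one (s c : ℝ) :
    periodizedGaussian s (c + 1) = periodizedGaussian s c := by
  unfold periodizedGaussian
  rw [← (Equiv.addRight (1 : ℤ)).tsum_eq (fun k : ℤ => Real.exp (-Real.pi * s * (k + c) ^ 2))]
  refine tsum_congr fun k => ?_
  simp only [Equiv.coe_addRight]
  push_cast
  ring_nf

lemma periodizedGaussian_neg (s c : ℝ) :
    periodizedGaussian s (-c) = periodizedGaussian s c := by
  unfold periodizedGaussian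
  rw [← (Equiv.neg ℤ).tsum_eq (fun k : ℤ => Real.exp (-Real.pi * s * (k + c) ^ 2))]
  refine tsum_congr fun k => ?_
  simp only [Equiv.neg_apply]
  push_cast
  ring_nf

/-- Integers are even or odd. -/
def evenOddEquiv : ℤ ⊕ ℤ ≃ ℤ :=
  Equiv.ofBijective (Sum.elim (fun p => 2 * p) (fun p => 2 * p + 1)) (by
    constructor
    · rintro (p | p) (q | q) h <;> simp only [Sum.elim_inl, Sum.elim_inr] at h
      · congr 1; omega
      · omega
      · omega
      · congr 1; omega
    · intro n
      rcases Int.even_or_odd' n with ⟨k, rfl | rfl⟩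
      exacts [⟨Sum.inl k, rfl⟩, ⟨Sum.inr k, rfl⟩])

/-- Pairs of integers, split by the parity of their sum. -/
def parityEquiv : (ℤ × ℤ) ⊕ (ℤ × ℤ) ≃ ℤ × ℤ :=
  Equiv.ofBijective
    (Sum.elim (fun p => (p.1 + p.2, p.1 - p.2)) (fun p => (p.1 + p.2 + 1, p.1 - p.2))) (by
    constructor
    · rintro (⟨p, q⟩ | ⟨p, q⟩) (⟨p', q'⟩ | ⟨p', q'⟩) h <;>
        simp only [Sum.elim_inl, Sum.elim_inr, Prod.mk.injEq] at h
      · congr 2 <;> omega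
      · omega
      · omega
      · congr 2 <;> omega
    · rintro ⟨m, n⟩
      rcases Int.even_or_odd' (m + n) with ⟨k, h | h⟩
      · exact ⟨Sum.inl (k, m - k), by ext <;> simp only [Sum.elim_inl] <;> omega⟩
      · exact ⟨Sum.inr (k, m - k - 1), by ext <;> simp only [Sum.elim_inr] <;> omega⟩)

lemma evenOddEquiv_inl (p : ℤ) : evenOddEquiv (Sum.inl p) = 2 * p := rfl

lemma evenOddEquiv_inr (p : ℤ) : evenOddEquiv (Sum.inr p) = 2 * p + 1 := rfl

lemma parityEquiv_inl (p : ℤ × ℤ) : parityEquiv (Sum.inl p) = (p.1 + p.2, p.1 - p.2) := rfl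

lemma parityEquiv_inr (p : ℤ × ℤ) : parityEquiv (Sum.inr p) = (p.1 + p.2 + 1, p.1 - p.2) := rfl

lemma periodizedGaussian_split {s : ℝ} (hs : 0 < s) (x : ℝ) :
    periodizedGaussian (4 * s) x + periodizedGaussian (4 * s) (x + 1 / 2) =
      periodizedGaussian s (2 * x) := by
  have h := summable_periodizedGaussian hs (2 * x)
  have h4 : 0 < 4 * s := by positivity
  conv_rhs => rw [periodizedGaussian, ← evenOddEquiv.tsum_eq]
  rw [← evenOddEquiv.summable_iff] at h
  rw [Summable.tsum_sum]
  · unfold periodizedGaussian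
    congr 1 <;> refine tsum_congr fun k => ?_ <;> simp only [evenOddEquiv_inl,
      evenOddEquiv_inr] <;> push_cast <;> ring_nf
  · exact h.comp_injective Sum.inl_injective
  · exact h.comp_injective Sum.inr_injective

/-- The change of variables `(m, n) = (p + q, p - q)` diagonalizes the quadratic form, since
`(p+q+c)² + (p-q+d)² = 2(p + (c+d)/2)² + 2(q + (c-d)/2)²`. It reaches only pairs of even sum; the
odd pairs give the second product. -/
lemma periodizedGaussian_mul {s : ℝ} (hs : 0 < s) (c d : ℝ) :
    periodizedGaussian s c * periodizedGaussian s d =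
      periodizedGaussian (2 * s) ((c + d) / 2) * periodizedGaussian (2 * s) ((c - d) / 2) +
      periodizedGaussian (2 * s) ((c + d + 1) / 2) *
        periodizedGaussian (2 * s) ((c - d + 1) / 2) := by
  have h2 : 0 < 2 * s := by positivity
  have key : ∀ {s : ℝ}, 0 < s → ∀ c d : ℝ, Summable (fun p : ℤ × ℤ =>
      Real.exp (-Real.pi * s * (p.1 + c) ^ 2) * Real.exp (-Real.pi * s * (p.2 + d) ^ 2)) ∧
      periodizedGaussian s c * periodizedGaussian s d = ∑' p : ℤ × ℤ,
      Real.exp (-Real.pi * s * (p.1 + c) ^ 2) * Real.exp (-Real.pi * s * (p.2 + d) ^ 2) := by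
    intro s hs c d
    have hS := (summable_periodizedGaussian hs c).mul_of_nonneg (summable_periodizedGaussian hs d)
      (fun _ => (Real.exp_pos _).le) (fun _ => (Real.exp_pos _).le)
    exact ⟨hS, (summable_periodizedGaussian hs c).tsum_mul_tsum
      (summable_periodizedGaussian hs d) hS⟩
  obtain ⟨hS, hE⟩ := key hs c d
  rw [hE, (key h2 _ _).2, (key h2 _ _).2, ← parityEquiv.tsum_eq]
  rw [← parityEquiv.summable_iff] at hS
  rw [Summable.tsum_sum]
  · congr 1 <;> refine tsum_congr fun k => ?_ <;> simp only [parityEquiv_inl,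
      parityEquiv_inr, ← Real.exp_add] <;> push_cast <;> ring_nf
  · exact hS.comp_injective Sum.inl_injective
  · exact hS.comp_injective Sum.inr_injective

/-- The duplication inequality that forces the minimum of the periodized Gaussian to be
attained at the half-integers. -/
lemma periodizedGaussian_duplication {s : ℝ} (hs : 0 < s) (v : ℝ) :
    periodizedGaussian s (1 / 2) ^ 3 * periodizedGaussian s (1 / 2 + 2 * v) ≤
      periodizedGaussian s (1 / 2 + v) ^ 4 := by
  have h2 : 0 < 2 * s := by positivity
  have e1 := periodizedGaussian_mul hs (1 / 2 + v) (1 / 2 + v)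
  have e2 := periodizedGaussian_mul hs (1 / 2) (1 / 2)
  have e3 := periodizedGaussian_mul h2 (1 / 2 + v) (1 + v)
  have e4 := periodizedGaussian_mul h2 (1 / 2) 1
  have s1 := periodizedGaussian_split hs (3 / 4 + v)
  have s2 := periodizedGaussian_split hs (3 / 4)
  have p0 := periodizedGaussian_add_one (2 * s) 0
  have p1 := periodizedGaussian_add_one s (1 / 2 + 2 * v)
  have p2 := periodizedGaussian_add_one s (1 / 2)
  have p3 := periodizedGaussian_neg (2 * (2 * s)) (1 / 4)
  ring_nf at e1 e2 e3 e4 s1 s2 p0 p1 p2 p3 ⊢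
  rw [p3] at e3 e4
  rw [p1] at s1
  rw [p2] at s2
  rw [p0] at e2 e4
  set M := periodizedGaussian (s * 2) 0
  set m := periodizedGaussian (s * 2) (1 / 2)
  set u := periodizedGaussian (s * 2) (1 / 2 + v)
  set u' := periodizedGaussian (s * 2) (1 + v)
  set q := periodizedGaussian (s * 4) (1 / 4)
  set T := periodizedGaussian s (1 / 2 + v)
  set T0 := periodizedGaussian s (1 / 2)
  set T2 := periodizedGaussian s (1 / 2 + v * 2)
  have hT0 : 0 < T0 := periodizedGaussian_pos hs _
  -- At `v = 0` the product formula gives `T0² = 2mM`, and applied once more at parameter `2s` it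
  -- gives `mM = q T0`.
  have hq : T0 = 2 * q := by
    have : T0 * (T0 - 2 * q) = 0 := by linear_combination e2 + 2 * e4 + 2 * q * s2
    rcases mul_eq_zero.1 this with h | h
    · exact absurd h hT0.ne'
    · linarith
  have e5 : u * u' = q * T2 := by linear_combination e3 + q * s1
  have e6 : m * M = q * T0 := by linear_combination e4 + q * s2
  -- With `T² = uM + u'm`, the claim becomes the inequality of arithmetic and geometric means for
  -- `uM` and `u'm`.
  calc T0 ^ 3 * T2 = 4 * (m * M) * (u * u') := by rw [e5, e6, hq]; ring
    _ ≤ (u * M + u' * m) ^ 2 := by nlinarith [sq_nonneg (u * M - u' * m)]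
    _ = T ^ 4 := by rw [← e1]; ring

/-- The Poisson summation formula for the periodized Gaussian. -/
lemma hasSum_gaussian_mul_cos {μ : ℝ} (hμ : 0 < μ) (c : ℝ) :
    HasSum (fun n : ℤ => Real.exp (-Real.pi * μ * n ^ 2) * Real.cos (2 * Real.pi * n * c))
      (1 / μ ^ (1 / 2 : ℝ) * periodizedGaussian (1 / μ) c) := by
  have h1 := HurwitzZeta.hasSum_int_evenKernel c (t := 1 / μ) (by positivity)
  have h2 := HurwitzZeta.hasSum_int_cosKernel c (t := μ) hμ
  have h3 := HurwitzZeta.evenKernel_functional_equation c (1 / μ)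
  have h4 : periodizedGaussian (1 / μ) c = HurwitzZeta.evenKernel c (1 / μ) := by
    rw [← h1.tsum_eq]
    refine tsum_congr fun k => ?_
    ring_nf
  have h5 := (Complex.hasSum_re h2)
  rw [Complex.ofReal_re] at h5
  convert h5 using 1
  · ext n
    rw [Complex.re_mul_ofReal, show (2 * Real.pi * Complex.I * c * n : ℂ) =
      ((2 * Real.pi * n * c : ℝ) : ℂ) * Complex.I by push_cast; ring,
      Complex.exp_ofReal_mul_I_re]
    ring_nf
  · rw [h4, h3, one_div_one_div, Real.div_rpow zero_le_one hμ.le, Real.one_rpow, one_div_one_div,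
      ← mul_assoc, one_div_mul_cancel (by positivity), one_mul]

lemma continuous_periodizedGaussian {s : ℝ} (hs : 0 < s) : Continuous (periodizedGaussian s) := by
  have h : ∀ c, periodizedGaussian s c = (1 / s) ^ (1 / 2 : ℝ) *
      ∑' n : ℤ, Real.exp (-Real.pi * (1 / s) * n ^ 2) * Real.cos (2 * Real.pi * n * c) := by
    intro c
    rw [(hasSum_gaussian_mul_cos (one_div_pos.2 hs) c).tsum_eq, one_div_one_div, ← mul_assoc,
      mul_one_div_cancel (by positivity), one_mul]
  rw [show periodizedGaussian s = _ from funext h]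
  refine continuous_const.mul (continuous_tsum (fun n => by fun_prop) ?_ ?_
    (u := fun n : ℤ => Real.exp (-Real.pi * (1 / s) * n ^ 2)))
  · simpa using summable_periodizedGaussian (one_div_pos.2 hs) 0
  · intro n x
    rw [norm_mul, Real.norm_eq_abs, Real.abs_exp]
    exact mul_le_of_le_one_right (Real.exp_pos _).le (Real.abs_cos_le_one _)

/-- The periodized Gaussian is smallest at the half-integers. -/
lemma periodizedGaussian_half_le {s : ℝ} (hs : 0 < s) (c : ℝ) :
    periodizedGaussian s (1 / 2) ≤ periodizedGaussian s c := by
  have hper : Function.Periodic (periodizedGaussian s) 1 := periodizedGaussian_add_one s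
  obtain ⟨c₀, -, hc₀⟩ := isCompact_Icc.exists_isMinOn (Set.nonempty_Icc.2 (zero_le_one' ℝ))
    (continuous_periodizedGaussian hs).continuousOn
  have hmin : ∀ x, periodizedGaussian s c₀ ≤ periodizedGaussian s x := by
    intro x
    obtain ⟨y, hy, hxy⟩ := hper.exists_mem_Ico₀ zero_lt_one x
    rw [hxy]
    exact hc₀ ⟨hy.1, hy.2.le⟩
  refine le_trans ?_ (hmin c)
  -- Write `P` for the periodized Gaussian and `c₀ = 1/2 + v` for a minimizer. Bounding `P (1/2 +
  -- 2v)` below by `P c₀` turns duplication into `P (1/2)³ P c₀ ≤ P c₀⁴`, that is `P (1/2) ≤ P c₀`.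
  have h1 := periodizedGaussian_duplication hs (c₀ - 1 / 2)
  have h2 := hmin (1 / 2 + 2 * (c₀ - 1 / 2))
  rw [add_sub_cancel] at h1
  have p0 := periodizedGaussian_pos hs (1 / 2)
  have p1 := periodizedGaussian_pos hs c₀
  refine le_of_pow_le_pow_left₀ three_ne_zero p1.le (le_of_mul_le_mul_right ?_ p1)
  calc _ ≤ _ := mul_le_mul_of_nonneg_left h2 (by positivity)
    _ ≤ _ := h1
    _ = _ := by ring

/-! ### Inequalities for alternating Gaussian sums. -/

lemma summable_gaussian_int {μ : ℝ} (hμ : 0 < μ) :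
    Summable fun n : ℤ => Real.exp (-Real.pi * μ * n ^ 2) := by
  simpa using summable_periodizedGaussian hμ 0

lemma tsum_gaussian_even {μ : ℝ} (hμ : 0 < μ) {φ : ℤ → ℝ} (hφ : ∀ n, |φ n| ≤ 1)
    (heven : ∀ n, φ (-n) = φ n) :
    ∑' n : ℤ, Real.exp (-Real.pi * μ * n ^ 2) * φ n =
      φ 0 + 2 * ∑' n : ℕ, Real.exp (-Real.pi * μ * (n + 1) ^ 2) * φ (n + 1) := by
  obtain ⟨f, hf⟩ : ∃ f : ℤ → ℝ, f = fun n : ℤ => Real.exp (-Real.pi * μ * n ^ 2) * φ n := ⟨_, rfl⟩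
  have hs : Summable f := by
    rw [hf]
    refine (summable_gaussian_int hμ).of_norm_bounded fun n => ?_
    rw [norm_mul, Real.norm_eq_abs, Real.abs_exp]
    exact mul_le_of_le_one_right (Real.exp_pos _).le (hφ n)
  have hp : Summable fun n : ℕ => f n := hs.comp_injective Nat.cast_injective
  have hm : Summable fun n : ℕ => f (-(n + 1)) :=
    hs.comp_injective (i := fun n : ℕ => -((n : ℤ) + 1)) fun a b h => by simpa using h
  have h1 := tsum_of_nat_of_neg_add_one hp hm
  rw [hp.tsum_eq_zero_add, tsum_congr (fun n : ℕ => show f (-(n + 1)) = f ((n + 1 : ℕ) : ℤ) by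
    simp only [hf, heven]; push_cast; ring_nf)] at h1
  rw [← hf, h1, hf]
  push_cast
  simp
  ring

lemma summable_gaussian_succ {μ : ℝ} (hμ : 0 < μ) (k : ℕ) :
    Summable fun n : ℕ => ((n : ℝ) + 1) ^ k * Real.exp (-Real.pi * μ * (n + 1) ^ 2) := by
  refine (HurwitzKernelBounds.summable_f_nat k 1 hμ).congr fun n => ?_
  simp only [HurwitzKernelBounds.f_nat]
  ring_nf

lemma summable_gaussian_succ_mul {μ : ℝ} (hμ : 0 < μ) (k : ℕ) {a : ℕ → ℝ} {C : ℝ}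
    (ha : ∀ n, |a n| ≤ C * ((n : ℝ) + 1) ^ k) :
    Summable fun n : ℕ => Real.exp (-Real.pi * μ * (n + 1) ^ 2) * a n := by
  refine ((summable_gaussian_succ hμ k).mul_left C).of_norm_bounded fun n => ?_
  rw [norm_mul, Real.norm_eq_abs, Real.abs_exp, mul_comm, ← mul_assoc]
  exact mul_le_mul_of_nonneg_right (ha n) (Real.exp_pos _).le

lemma cos_pi_mul_succ (n : ℕ) : Real.cos (Real.pi * (n + 1)) = (-1) ^ (n + 1) := by
  simpa [mul_comm] using Real.cos_nat_mul_pi (n + 1)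

lemma tsum_gaussian_cos_eq {μ : ℝ} (hμ : 0 < μ) (c : ℝ) :
    1 + 2 * ∑' n : ℕ, Real.exp (-Real.pi * μ * (n + 1) ^ 2) * Real.cos (2 * Real.pi * (n + 1) * c)
      = 1 / μ ^ (1 / 2 : ℝ) * periodizedGaussian (1 / μ) c := by
  rw [← (hasSum_gaussian_mul_cos hμ c).tsum_eq, tsum_gaussian_even hμ
    (φ := fun n => Real.cos (2 * Real.pi * n * c)) (fun n => Real.abs_cos_le_one _)
    (fun n => by rw [← Real.cos_neg]; push_cast; ring_nf)]
  simp

lemma tsum_gaussian_alternating_eq {μ : ℝ} (hμ : 0 < μ) :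
    1 + 2 * ∑' n : ℕ, Real.exp (-Real.pi * μ * (n + 1) ^ 2) * (-1) ^ (n + 1)
      = 1 / μ ^ (1 / 2 : ℝ) * periodizedGaussian (1 / μ) (1 / 2) := by
  rw [← tsum_gaussian_cos_eq hμ]
  simp_rw [← cos_pi_mul_succ]
  ring_nf

/-- The theta function `1 + 2 ∑ exp (-π μ n^2) cos (2 π n c)` is smallest at `c = 1 / 2`. -/
lemma tsum_gaussian_alternating_le {μ : ℝ} (hμ : 0 < μ) (c : ℝ) :
    ∑' n : ℕ, Real.exp (-Real.pi * μ * (n + 1) ^ 2) * (-1) ^ (n + 1) ≤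
      ∑' n : ℕ, Real.exp (-Real.pi * μ * (n + 1) ^ 2) * Real.cos (2 * Real.pi * (n + 1) * c) := by
  have h1 := tsum_gaussian_cos_eq hμ c
  have h2 := tsum_gaussian_alternating_eq hμ
  have h3 := mul_le_mul_of_nonneg_left
    (periodizedGaussian_half_le (one_div_pos.2 hμ) c) (show 0 ≤ 1 / μ ^ (1 / 2 : ℝ) by positivity)
  linarith

/-- By Poisson summation, one plus twice this sum is a positive multiple of a periodized Gaussian.
-/
lemma tsum_gaussian_alternating_ge {μ : ℝ} (hμ : 0 < μ) :
    -(1 / 2) ≤ ∑' n : ℕ, Real.exp (-Real.pi * μ * (n + 1) ^ 2) * (-1) ^ (n + 1) := by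
  have h2 := tsum_gaussian_alternating_eq hμ
  have h3 : 0 ≤ 1 / μ ^ (1 / 2 : ℝ) * periodizedGaussian (1 / μ) (1 / 2) := by
    have := (periodizedGaussian_pos (one_div_pos.2 hμ) (1 / 2)).le
    positivity
  linarith

/-- The minimum of the theta function on the unit circle is a bound inside the unit disc. -/
lemma tsum_gaussian_alternating_le_pow {μ : ℝ} (hμ : 0 < μ) {r : ℝ} (h0 : 0 ≤ r) (h1 : r ≤ 1) :
    ∑' n : ℕ, Real.exp (-Real.pi * μ * (n + 1) ^ 2) * (-1) ^ (n + 1) ≤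
      ∑' n : ℕ, Real.exp (-Real.pi * μ * (n + 1) ^ 2) * (-r) ^ (n + 1) := by
  have hsum : Summable fun n : ℕ => Real.exp (-Real.pi * μ * (n + 1) ^ 2) := by
    simpa using summable_gaussian_succ hμ 0
  set F : ℂ → ℂ := fun z => ∑' n : ℕ,
    (Real.exp (-Real.pi * μ * (n + 1) ^ 2) : ℂ) * z ^ (n + 1) with hF
  have hbd : ∀ (n : ℕ) (z : ℂ), z ∈ Metric.closedBall (0 : ℂ) 1 →
      ‖(Real.exp (-Real.pi * μ * (n + 1) ^ 2) : ℂ) * z ^ (n + 1)‖ ≤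
        Real.exp (-Real.pi * μ * (n + 1) ^ 2) := by
    intro n z hz
    rw [norm_mul, Complex.norm_real, Real.norm_eq_abs, Real.abs_exp, norm_pow]
    exact mul_le_of_le_one_right (Real.exp_pos _).le
      (pow_le_one₀ (norm_nonneg _) (by simpa using hz))
  have hcont : ContinuousOn F (Metric.closedBall 0 1) :=
    continuousOn_tsum (fun n => by fun_prop) hsum hbd
  have hdiff : DifferentiableOn ℂ F (Metric.ball 0 1) :=
    Complex.differentiableOn_tsum_of_summable_norm hsum (fun n => by fun_prop) Metric.isOpen_ball
      fun n z hz => hbd n z (Metric.ball_subset_closedBall hz)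
  -- The minimum principle for `Re F` is the maximum modulus principle for `exp (-F)`. On the
  -- circle, `Re F` is the cosine series, smallest at `z = -1`.
  have hd : DiffContOnCl ℂ (fun z => Complex.exp (-F z)) (Metric.ball 0 1) := by
    refine ⟨hdiff.neg.cexp, ?_⟩
    rw [closure_ball _ one_ne_zero]
    exact (Complex.continuous_exp.comp_continuousOn hcont.neg)
  have hFre : ∀ z ∈ Metric.closedBall (0 : ℂ) 1, (F z).re =
      ∑' n : ℕ, Real.exp (-Real.pi * μ * (n + 1) ^ 2) * (z ^ (n + 1)).re := by
    intro z hz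
    rw [hF, Complex.re_tsum (hsum.of_norm_bounded fun n => hbd n z hz)]
    simp only [Complex.re_ofReal_mul]
  have hreal : ∀ r : ℝ, ((-(r : ℂ)) ) = ((-r : ℝ) : ℂ) := fun r => by simp
  have hr : -(r : ℂ) ∈ Metric.closedBall (0 : ℂ) 1 := by simpa [abs_of_nonneg h0] using h1
  have key := Complex.norm_le_of_forall_mem_frontier_norm_le Metric.isBounded_ball hd
    (C := Real.exp (-(F (-1)).re)) (fun z hz => ?_) (z := -(r : ℂ))
    (by rw [closure_ball _ one_ne_zero]; exact hr)
  · rw [Complex.norm_exp, Complex.neg_re, Real.exp_le_exp, neg_le_neg_iff, hFre _ hr,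
      hFre _ (by simp)] at key
    simp only [hreal] at key
    have e1 : (-1 : ℂ) = ((-1 : ℝ) : ℂ) := by simp
    rw [e1] at key
    simp only [← Complex.ofReal_pow, Complex.ofReal_re] at key
    exact key
  · rw [frontier_ball _ one_ne_zero, mem_sphere_zero_iff_norm] at hz
    rw [Complex.norm_exp, Complex.neg_re, Real.exp_le_exp, neg_le_neg_iff,
      hFre (-1) (by simp), hFre z (by simp [hz])]
    have e1 : (-1 : ℂ) = ((-1 : ℝ) : ℂ) := by simp
    rw [e1]
    simp only [← Complex.ofReal_pow, Complex.ofReal_re]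
    refine (tsum_gaussian_alternating_le hμ (z.arg / (2 * Real.pi))).trans_eq ?_
    refine tsum_congr fun n => ?_
    congr 1
    conv_rhs => rw [← Complex.norm_mul_exp_arg_mul_I z, hz]
    rw [Complex.ofReal_one, one_mul, ← Complex.exp_nat_mul, ← mul_assoc]
    rw [show ((n + 1 : ℕ) : ℂ) * (z.arg : ℂ) = (((n + 1) * z.arg : ℝ) : ℂ) by push_cast; ring,
      Complex.exp_ofReal_mul_I_re]
    congr 1
    field_simp

/-- Up to a positive factor this is the second derivative of the theta function at its minimum `c =
1/2`. -/
lemma tsum_gaussian_alternating_sq_nonneg {μ : ℝ} (hμ : 0 < μ) :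
    0 ≤ ∑' n : ℕ, Real.exp (-Real.pi * μ * (n + 1) ^ 2) * ((-1) ^ n * ((n : ℝ) + 1) ^ 2) := by
  -- For `v ≠ 0`, `S v` is the increment of the cosine series from `1/2` to `1/2 + v` divided by
  -- `2π²v²`. Writing it with `sinc` makes it continuous at `v = 0`.
  set S : ℝ → ℝ := fun v => ∑' n : ℕ, Real.exp (-Real.pi * μ * (n + 1) ^ 2) *
    ((-1) ^ n * (((n : ℝ) + 1) ^ 2 * Real.sinc (Real.pi * (n + 1) * v) ^ 2)) with hS
  have hsinc : ∀ x : ℝ, |Real.sinc x ^ 2| ≤ 1 := fun x => by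
    rw [abs_pow]
    exact pow_le_one₀ (abs_nonneg _) (Real.abs_sinc_le_one x)
  have hcont : Continuous S := by
    refine continuous_tsum (fun n => ?_) (summable_gaussian_succ hμ 2) fun n v => ?_
    · have := Real.continuous_sinc
      fun_prop
    · rw [mul_comm, norm_mul, norm_mul, norm_pow, norm_neg, norm_one, one_pow, one_mul, norm_mul]
      simp only [Real.norm_eq_abs, Real.abs_exp]
      rw [abs_of_nonneg (show (0 : ℝ) ≤ ((n : ℝ) + 1) ^ 2 by positivity)]
      exact mul_le_mul_of_nonneg_right
        (mul_le_of_le_one_right (by positivity) (hsinc _)) (Real.exp_pos _).le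
  have hpos : ∀ v : ℝ, v ≠ 0 → 0 ≤ S v := by
    intro v hv
    have h := tsum_gaussian_alternating_le hμ (1 / 2 + v)
    rw [← sub_nonneg, ← Summable.tsum_sub] at h
    · have hc : (0 : ℝ) ≤ 1 / (2 * Real.pi ^ 2 * v ^ 2) := by positivity
      have h2 := mul_nonneg hc h
      rw [← tsum_mul_left] at h2
      refine h2.trans_eq (tsum_congr fun n => ?_)
      have hne : Real.pi * (n + 1) * v ≠ 0 := by positivity
      have hcos : Real.cos (2 * Real.pi * (n + 1) * (1 / 2 + v)) =
          (-1) ^ (n + 1) * Real.cos (2 * (Real.pi * (n + 1) * v)) := by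
        rw [show 2 * Real.pi * (n + 1) * (1 / 2 + v) =
          2 * (Real.pi * (n + 1) * v) + (n + 1 : ℕ) * Real.pi by push_cast; ring,
          Real.cos_add_nat_mul_pi]
      rw [hcos, Real.sinc_of_ne_zero hne, Real.cos_two_mul, Real.cos_sq', pow_succ]
      field_simp
      ring
    · exact summable_gaussian_succ_mul hμ 0 (C := 1) fun n => by
        simpa using Real.abs_cos_le_one _
    · exact summable_gaussian_succ_mul hμ 0 (C := 1) fun n => by simp
  have h0 : S 0 = ∑' n : ℕ, Real.exp (-Real.pi * μ * (n + 1) ^ 2) *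
      ((-1) ^ n * ((n : ℝ) + 1) ^ 2) := by
    simp [hS]
  rw [← h0]
  exact ge_of_tendsto (hcont.continuousAt.tendsto.mono_left nhdsWithin_le_nhds)
    (eventually_nhdsWithin_of_forall hpos : ∀ᶠ v in 𝓝[≠] 0, 0 ≤ S v)

lemma integral_exp_mul_one_sub_exp {t m : ℝ} (ht : 0 < t) (hm : 0 < m) :
    IntegrableOn (fun w => t * Real.exp (-t * w) * (1 - Real.exp (-m * w))) (Set.Ioi 0) ∧
    ∫ w in Set.Ioi (0 : ℝ), t * Real.exp (-t * w) * (1 - Real.exp (-m * w)) = m / (t + m) := by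
  have h1 := integrableOn_exp_mul_Ioi (neg_lt_zero.2 ht) 0
  have h2 := integrableOn_exp_mul_Ioi (neg_lt_zero.2 (add_pos ht hm)) 0
  have e : (fun w => t * Real.exp (-t * w) * (1 - Real.exp (-m * w))) =
      fun w => t * Real.exp (-t * w) - t * Real.exp (-(t + m) * w) := by
    ext w
    rw [show -(t + m) * w = -t * w + -m * w by ring, Real.exp_add]
    ring
  rw [e]
  refine ⟨(h1.const_mul t).sub (h2.const_mul t), ?_⟩
  rw [integral_sub (h1.const_mul t) (h2.const_mul t), integral_const_mul, integral_const_mul,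
    integral_exp_mul_Ioi (neg_lt_zero.2 ht), integral_exp_mul_Ioi (neg_lt_zero.2 (add_pos ht hm))]
  simp only [mul_zero, Real.exp_zero]
  field_simp
  ring

/-- Since `m/(t+m) = ∫₀^∞ t exp (-tw) (1 - exp (-mw)) dw`, the sum is the integral of `t exp (-tw)`
against the difference of the power series at `-exp (-w)` and at `-1`, which is nonnegative by
`tsum_gaussian_alternating_le_pow`. -/
lemma tsum_gaussian_alternating_div_nonneg {μ : ℝ} (hμ : 0 < μ) {t : ℝ} (ht : 0 < t) :
    0 ≤ ∑' n : ℕ, Real.exp (-Real.pi * μ * (n + 1) ^ 2) *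
      ((-1) ^ n * (((n : ℝ) + 1) / (t + (n + 1)))) := by
  have hm : ∀ n : ℕ, (0 : ℝ) < n + 1 := fun n => by positivity
  have hI := fun n : ℕ => integral_exp_mul_one_sub_exp ht (hm n)
  have H := hasSum_integral_of_summable_integral_norm (μ := volume.restrict (Set.Ioi (0 : ℝ)))
    (F := fun (n : ℕ) (w : ℝ) => (Real.exp (-Real.pi * μ * (n + 1) ^ 2) * (-1) ^ n) *
      (t * Real.exp (-t * w) * (1 - Real.exp (-((n : ℝ) + 1) * w))))
    (fun n => (hI n).1.const_mul _) ?_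
  · have e : ∀ n : ℕ, ∫ w in Set.Ioi (0 : ℝ), (Real.exp (-Real.pi * μ * (n + 1) ^ 2) * (-1) ^ n) *
      (t * Real.exp (-t * w) * (1 - Real.exp (-((n : ℝ) + 1) * w))) =
      Real.exp (-Real.pi * μ * (n + 1) ^ 2) * ((-1) ^ n * (((n : ℝ) + 1) / (t + (n + 1)))) := by
      intro n
      rw [integral_const_mul, (hI n).2, mul_assoc]
    simp only [e] at H
    rw [H.tsum_eq]
    refine setIntegral_nonneg measurableSet_Ioi fun w hw => ?_
    have hw' : 0 < w := hw
    have h := tsum_gaussian_alternating_le_pow hμ (Real.exp_pos (-w)).le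
      (Real.exp_le_one_iff.2 (by linarith))
    rw [← sub_nonneg, ← Summable.tsum_sub] at h
    · have h2 := mul_nonneg (mul_pos ht (Real.exp_pos (-t * w))).le h
      rw [← tsum_mul_left] at h2
      refine h2.trans_eq (tsum_congr fun n => ?_)
      rw [neg_pow (Real.exp (-w)), ← Real.exp_nat_mul, pow_succ]
      push_cast
      rw [show (n + 1) * -w = -((n : ℝ) + 1) * w by ring]
      ring
    · exact summable_gaussian_succ_mul hμ 0 (C := 1) fun n => by
        rw [abs_pow, abs_neg, Real.abs_exp, pow_zero, mul_one]
        exact pow_le_one₀ (Real.exp_pos _).le (Real.exp_le_one_iff.2 (by linarith))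
    · exact summable_gaussian_succ_mul hμ 0 (C := 1) fun n => by simp
  · have e : ∀ n : ℕ, ∫ w in Set.Ioi (0 : ℝ), ‖(Real.exp (-Real.pi * μ * (n + 1) ^ 2) * (-1) ^ n) *
      (t * Real.exp (-t * w) * (1 - Real.exp (-((n : ℝ) + 1) * w)))‖ =
      Real.exp (-Real.pi * μ * (n + 1) ^ 2) * (((n : ℝ) + 1) / (t + (n + 1))) := by
      intro n
      rw [← (hI n).2, ← integral_const_mul]
      refine setIntegral_congr_fun measurableSet_Ioi fun w hw => ?_
      have hw' : 0 < w := hw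
      have : 0 ≤ 1 - Real.exp (-((n : ℝ) + 1) * w) := by
        rw [sub_nonneg, Real.exp_le_one_iff]
        nlinarith [hm n]
      simp only [norm_mul, norm_pow, norm_neg, norm_one, one_pow, mul_one, Real.norm_eq_abs,
        Real.abs_exp, abs_of_pos ht, abs_of_nonneg this]
    simp only [e]
    refine summable_gaussian_succ_mul hμ 0 (C := 1) fun n => ?_
    have := hm n
    rw [abs_of_nonneg (by positivity), pow_zero, mul_one, div_le_one (by positivity)]
    linarith

/-! ### Partial fractions of the cosecant, and the even part of the sign inequality. -/

lemma ofReal_mem_integerComplement {x : ℝ} (hx : ∀ n : ℤ, x ≠ n) :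
    (x : ℂ) ∈ Complex.integerComplement := by
  rw [Complex.mem_integerComplement_iff]
  rintro ⟨n, hn⟩
  exact hx n (by exact_mod_cast hn.symm)

lemma sin_pi_mul_ne_zero_of_forall {x : ℝ} (hx : ∀ n : ℤ, x ≠ n) :
    Real.sin (Real.pi * x) ≠ 0 := by
  intro h
  obtain ⟨n, hn⟩ := Real.sin_eq_zero_iff.1 h
  refine hx n ?_
  rw [mul_comm] at hn
  exact (mul_left_cancel₀ Real.pi_ne_zero hn).symm

/-- The partial fraction expansion of the cosecant. -/
lemma hasSum_cosecant {x : ℝ} (hx : ∀ n : ℤ, x ≠ n) :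
    HasSum (fun n : ℕ => (-1 : ℝ) ^ (n + 1) * (2 * x / (x ^ 2 - ((n : ℝ) + 1) ^ 2)))
      (Real.pi / Real.sin (Real.pi * x) - 1 / x) := by
  have hx2 : ∀ n : ℤ, x / 2 ≠ n := fun n h => hx (2 * n) (by push_cast; linarith)
  have hz := ofReal_mem_integerComplement hx
  have hz2 := ofReal_mem_integerComplement hx2
  have hx0 : x ≠ 0 := by simpa using hx 0
  set a : ℕ → ℂ := fun n => cotTerm x n with ha
  have hsum : Summable a := summable_cotTerm hz
  have hev : Summable fun k => a (2 * k) :=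
    hsum.comp_injective (mul_right_injective₀ two_ne_zero)
  have hod : Summable fun k => a (2 * k + 1) :=
    hsum.comp_injective ((add_left_injective 1).comp (mul_right_injective₀ two_ne_zero))
  have htot : (∑' k, a (2 * k)) + ∑' k, a (2 * k + 1) =
      Real.pi * Complex.cot (Real.pi * x) - 1 / x := by
    rw [tsum_even_add_odd hev hod, cot_series_rep' hz]
  -- `cotTerm x n` has its poles at `±(n+1)`, so odd indices are the even poles, which form half the
  -- cotangent series at `x/2`. The alternating series is twice this minus the full series, and `csc
  -- 2y = cot y - cot 2y` finishes.
  have hodd : ∑' k, a (2 * k + 1) =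
      1 / 2 * (Real.pi * Complex.cot (Real.pi * (x / 2 : ℝ)) - 1 / (x / 2 : ℝ)) := by
    rw [cot_series_rep' hz2, ← tsum_mul_left]
    refine tsum_congr fun k => ?_
    have h1 : (x : ℂ) - (2 * k + 1 + 1) ≠ 0 := by
      intro h; exact hx (2 * k + 2) (by
        have : ((x - (2 * k + 1 + 1) : ℝ) : ℂ) = 0 := by push_cast; exact h
        rw [Complex.ofReal_eq_zero] at this
        push_cast; linarith)
    have h2 : (x : ℂ) + (2 * k + 1 + 1) ≠ 0 := by
      intro h; exact hx (-(2 * k + 2)) (by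
        have : ((x + (2 * k + 1 + 1) : ℝ) : ℂ) = 0 := by push_cast; exact h
        rw [Complex.ofReal_eq_zero] at this
        push_cast; linarith)
    simp only [ha, cotTerm]
    push_cast
    rw [show (x : ℂ) / 2 - (k + 1) = (x - (2 * k + 1 + 1)) / 2 by ring,
      show (x : ℂ) / 2 + (k + 1) = (x + (2 * k + 1 + 1)) / 2 by ring]
    field_simp
  have halt : HasSum (fun n => (-1 : ℂ) ^ (n + 1) * a n)
      (-(∑' k, a (2 * k)) + ∑' k, a (2 * k + 1)) := by
    refine HasSum.even_add_odd ?_ ?_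
    · convert! hev.hasSum.neg using 2 with k
      rw [pow_succ, pow_mul]
      simp
    · convert! hod.hasSum using 2 with k
      rw [show 2 * k + 1 + 1 = 2 * (k + 1) by ring, pow_mul]
      simp
  rw [← Complex.hasSum_ofReal]
  convert! halt using 1
  · ext n
    simp only [ha]
    rw [cotTerm_identity hz]
    push_cast
    ring_nf
  · have hs : Complex.sin (Real.pi * x) ≠ 0 := sin_pi_mul_ne_zero hz
    have hs2 : Complex.sin (Real.pi * (x / 2 : ℝ)) ≠ 0 := sin_pi_mul_ne_zero hz2
    have hx0' : (x : ℂ) ≠ 0 := by exact_mod_cast hx0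
    rw [show -(∑' k, a (2 * k)) + ∑' k, a (2 * k + 1) = 2 * (∑' k, a (2 * k + 1)) -
      ((∑' k, a (2 * k)) + ∑' k, a (2 * k + 1)) by ring, htot, hodd]
    rw [Complex.cot, Complex.cot]
    have e : (Real.pi * x : ℂ) = 2 * (Real.pi * (x / 2 : ℝ)) := by push_cast; ring
    have hc : Complex.cos (Real.pi * (x / 2 : ℝ)) ≠ 0 := by
      intro h
      apply hs
      rw [e, Complex.sin_two_mul, h, mul_zero]
    push_cast at e ⊢
    rw [e, Complex.sin_two_mul, Complex.cos_two_mul]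
    push_cast at hs2 hc
    have : ∀ s c p y : ℂ, s ≠ 0 → c ≠ 0 → y ≠ 0 → p / (2 * s * c) - 1 / y =
      2 * (1 / 2 * (p * (c / s) - 1 / (y / 2))) - (p * ((2 * c ^ 2 - 1) / (2 * s * c)) - 1 / y) := by
      intro s c p y hs hc hy
      field_simp
      ring
    exact this _ _ _ _ hs2 hc hx0'

/-- Each term of the absolutely convergent cosecant series is at most its total; the added `1` only
makes the constant positive. -/
lemma exists_abs_inv_sq_sub_sq_le {x : ℝ} (hx : ∀ n : ℤ, x ≠ n) :
    ∃ C : ℝ, 0 < C ∧ ∀ n : ℕ, |1 / (x ^ 2 - ((n : ℝ) + 1) ^ 2)| ≤ C := by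
  have h := (hasSum_cosecant hx).summable.abs
  have hx0 : x ≠ 0 := by simpa using hx 0
  refine ⟨(∑' n : ℕ, |(-1 : ℝ) ^ (n + 1) * (2 * x / (x ^ 2 - ((n : ℝ) + 1) ^ 2))|) / (2 * |x|) + 1,
    by positivity, fun n => ?_⟩
  have h1 := h.le_tsum n fun _ _ => abs_nonneg _
  rw [abs_mul, abs_pow, abs_neg, abs_one, one_pow, one_mul, div_eq_mul_one_div, abs_mul, abs_mul,
    abs_two, ← le_div_iff₀' (by positivity)] at h1
  linarith

lemma sq_sub_sq_ne_zero {x : ℝ} (hx : ∀ n : ℤ, x ≠ n) (n : ℕ) :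
    x ^ 2 - ((n : ℝ) + 1) ^ 2 ≠ 0 := by
  intro h
  rw [sub_eq_zero, sq_eq_sq_iff_eq_or_eq_neg] at h
  rcases h with h | h
  · exact hx (n + 1) (by push_cast; exact h)
  · exact hx (-(n + 1)) (by push_cast; exact h)

/-- Multiplied by `exp (πμx²)`, the expression becomes `U μ`, and differentiating in `μ` cancels the
denominators `x² - m²`. What remains is a positive multiple of the sum in
`tsum_gaussian_alternating_sq_nonneg`, so `U` is nondecreasing. It then suffices to bound `U` from
below near `μ = 0`. -/
lemma tsum_gaussian_even_part_nonneg {μ : ℝ} (hμ : 0 < μ) {x : ℝ} (hx0 : 0 < x)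
    (hx : ∀ n : ℤ, x ≠ n) :
    0 ≤ Real.pi * Real.exp (-Real.pi * μ * x ^ 2) / Real.sin (Real.pi * x) +
      ∑' n : ℕ, Real.exp (-Real.pi * μ * (n + 1) ^ 2) *
        ((-1) ^ n * (2 * ((n : ℝ) + 1) ^ 2 / (x * (x ^ 2 - ((n : ℝ) + 1) ^ 2)))) := by
  obtain ⟨C, hC, hCn⟩ := exists_abs_inv_sq_sub_sq_le hx
  have hd := sq_sub_sq_ne_zero hx
  have hs := sin_pi_mul_ne_zero_of_forall hx
  set c : ℕ → ℝ := fun n => (-1) ^ n * (2 * ((n : ℝ) + 1) ^ 2 / (x * (x ^ 2 - ((n : ℝ) + 1) ^ 2)))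
    with hc
  have hcb : ∀ n, |c n| ≤ 2 / x * C * ((n : ℝ) + 1) ^ 2 := by
    intro n
    simp only [hc]
    rw [show 2 * ((n : ℝ) + 1) ^ 2 / (x * (x ^ 2 - ((n : ℝ) + 1) ^ 2)) =
      2 / x * ((n : ℝ) + 1) ^ 2 * (1 / (x ^ 2 - ((n : ℝ) + 1) ^ 2)) by
        have := hd n
        field_simp, abs_mul, abs_pow, abs_neg, abs_one, one_pow,
      one_mul, abs_mul, abs_of_nonneg (show 0 ≤ 2 / x * ((n : ℝ) + 1) ^ 2 by positivity),
      mul_right_comm]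
    exact mul_le_mul_of_nonneg_right (mul_le_mul_of_nonneg_left (hCn n) (by positivity))
      (by positivity)
  have hexp : ∀ (μ : ℝ) (n : ℕ), Real.exp (Real.pi * μ * (x ^ 2 - ((n : ℝ) + 1) ^ 2)) =
      Real.exp (Real.pi * μ * x ^ 2) * Real.exp (-Real.pi * μ * (n + 1) ^ 2) := by
    intro μ n
    rw [← Real.exp_add]; ring_nf
  have hsm : ∀ {μ : ℝ}, 0 < μ →
      Summable fun n : ℕ => Real.exp (-Real.pi * μ * (n + 1) ^ 2) * c n :=
    fun hμ => summable_gaussian_succ_mul hμ 2 hcb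
  set U : ℝ → ℝ := fun μ => Real.pi / Real.sin (Real.pi * x) +
    ∑' n : ℕ, Real.exp (Real.pi * μ * (x ^ 2 - ((n : ℝ) + 1) ^ 2)) * c n with hU
  have hU' : ∀ μ, U μ = Real.exp (Real.pi * μ * x ^ 2) *
      (Real.pi * Real.exp (-Real.pi * μ * x ^ 2) / Real.sin (Real.pi * x) +
      ∑' n : ℕ, Real.exp (-Real.pi * μ * (n + 1) ^ 2) * c n) := by
    intro μ
    simp only [hU, hexp]
    rw [mul_add, ← tsum_mul_left]
    congr 1
    · have : Real.exp (Real.pi * μ * x ^ 2) * Real.exp (-Real.pi * μ * x ^ 2) = 1 := by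
        rw [← Real.exp_add]; simp
      rw [mul_div_assoc', mul_left_comm, this, mul_one]
    · refine tsum_congr fun n => ?_
      ring
  have hderiv : ∀ μ : ℝ, 0 < μ → HasDerivAt U (2 * Real.pi / x * Real.exp (Real.pi * μ * x ^ 2) *
      ∑' n : ℕ, Real.exp (-Real.pi * μ * (n + 1) ^ 2) * ((-1) ^ n * ((n : ℝ) + 1) ^ 2)) μ := by
    intro μ hμ
    have hcd : ∀ n, c n * (Real.pi * (x ^ 2 - ((n : ℝ) + 1) ^ 2)) =
        2 * Real.pi / x * ((-1) ^ n * ((n : ℝ) + 1) ^ 2) := by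
      intro n
      have := hd n
      simp only [hc]
      field_simp
    have H := hasDerivAt_tsum_of_isPreconnected (𝕜 := ℝ) (F := ℝ)
      (g := fun (n : ℕ) μ => Real.exp (Real.pi * μ * (x ^ 2 - ((n : ℝ) + 1) ^ 2)) * c n)
      (g' := fun (n : ℕ) μ => Real.exp (Real.pi * μ * (x ^ 2 - ((n : ℝ) + 1) ^ 2)) *
        (2 * Real.pi / x * ((-1) ^ n * ((n : ℝ) + 1) ^ 2)))
      -- On this window `exp (πyx²)` is bounded by its value at `2μ` and the Gaussian weights by
      -- theirs at `μ/2`, which gives a summable majorant for the derivatives.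
      (t := Set.Ioo (μ / 2) (2 * μ)) (y₀ := μ) (y := μ)
      (u := fun n : ℕ => 2 * Real.pi / x * Real.exp (Real.pi * (2 * μ) * x ^ 2) *
        (((n : ℝ) + 1) ^ 2 * Real.exp (-Real.pi * (μ / 2) * (n + 1) ^ 2)))
      ((summable_gaussian_succ (half_pos hμ) 2).mul_left _) isOpen_Ioo isPreconnected_Ioo
      ?_ ?_ ⟨by linarith, by linarith⟩ ?_ ⟨by linarith, by linarith⟩
    · convert! (H.const_add (Real.pi / Real.sin (Real.pi * x))) using 1
      rw [← tsum_mul_left]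
      refine tsum_congr fun n => ?_
      rw [hexp]
      ring
    · intro n y _
      have h1 : HasDerivAt (fun μ => Real.pi * μ * (x ^ 2 - ((n : ℝ) + 1) ^ 2))
          (Real.pi * (x ^ 2 - ((n : ℝ) + 1) ^ 2)) y := by
        simpa using ((hasDerivAt_id y).const_mul Real.pi).mul_const (x ^ 2 - ((n : ℝ) + 1) ^ 2)
      convert! (h1.exp.mul_const (c n)) using 1
      rw [← hcd]
      ring
    · intro n y hy
      rw [hexp, norm_mul, norm_mul, Real.norm_eq_abs, Real.abs_exp, Real.norm_eq_abs,
        Real.abs_exp, Real.norm_eq_abs, abs_mul, abs_of_pos (show 0 < 2 * Real.pi / x by positivity),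
        abs_mul, abs_pow, abs_neg, abs_one, one_pow, one_mul,
        abs_of_nonneg (show (0 : ℝ) ≤ ((n : ℝ) + 1) ^ 2 by positivity)]
      have e1 : Real.exp (Real.pi * y * x ^ 2) ≤ Real.exp (Real.pi * (2 * μ) * x ^ 2) := by
        have := hy.2.le
        gcongr
      have e2 : Real.exp (-Real.pi * y * (n + 1) ^ 2) ≤
          Real.exp (-Real.pi * (μ / 2) * (n + 1) ^ 2) := by
        have h := hy.1.le
        rw [neg_mul, neg_mul, neg_mul, neg_mul]
        gcongr
      calc _ = 2 * Real.pi / x * (Real.exp (Real.pi * y * x ^ 2) *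
            (((n : ℝ) + 1) ^ 2 * Real.exp (-Real.pi * y * (n + 1) ^ 2))) := by ring
        _ ≤ 2 * Real.pi / x * (Real.exp (Real.pi * (2 * μ) * x ^ 2) *
            (((n : ℝ) + 1) ^ 2 * Real.exp (-Real.pi * (μ / 2) * (n + 1) ^ 2))) := by gcongr
        _ = _ := by ring
    · refine ((hsm hμ).mul_left (Real.exp (Real.pi * μ * x ^ 2))).congr fun n => ?_
      rw [hexp]
      ring
  have hmono : MonotoneOn U (Set.Ioi 0) := by
    refine monotoneOn_of_deriv_nonneg (convex_Ioi 0)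
      (fun y hy => (hderiv y hy).continuousAt.continuousWithinAt) ?_ ?_
    · rw [interior_Ioi]
      exact fun y hy => (hderiv y hy).differentiableAt.differentiableWithinAt
    · rw [interior_Ioi]
      intro y hy
      rw [(hderiv y hy).deriv]
      exact mul_nonneg (by positivity) (tsum_gaussian_alternating_sq_nonneg hy)
  have hcos := hasSum_cosecant hx
  -- Since `2m²/(x(x²-m²)) = -2/x + 2x/(x²-m²)`, and `tsum_gaussian_alternating_ge` bounds the
  -- contribution of `-2/x` below by `-1/x`, `W ν` is a lower bound for `exp (-πνx²) U ν`. It tends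
  -- to `0` as `ν → 0⁺` by the cosecant expansion.
  set W : ℝ → ℝ := fun ν => Real.pi * Real.exp (-Real.pi * ν * x ^ 2) / Real.sin (Real.pi * x) -
    1 / x - ∑' n : ℕ, Real.exp (-Real.pi * ν * (n + 1) ^ 2) *
      ((-1 : ℝ) ^ (n + 1) * (2 * x / (x ^ 2 - ((n : ℝ) + 1) ^ 2))) with hW
  have hbdW : ∀ ν : ℝ, 0 < ν → ∀ n : ℕ, ‖Real.exp (-Real.pi * ν * (n + 1) ^ 2) *
      ((-1 : ℝ) ^ (n + 1) * (2 * x / (x ^ 2 - ((n : ℝ) + 1) ^ 2)))‖ ≤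
      |(-1 : ℝ) ^ (n + 1) * (2 * x / (x ^ 2 - ((n : ℝ) + 1) ^ 2))| := by
    intro ν hν n
    rw [norm_mul, Real.norm_eq_abs, Real.abs_exp, Real.norm_eq_abs]
    refine mul_le_of_le_one_left (abs_nonneg _) (Real.exp_le_one_iff.2 ?_)
    have : 0 ≤ Real.pi * ν * ((n : ℝ) + 1) ^ 2 := by positivity
    linarith
  have hlow : ∀ ν ∈ Set.Ioo 0 μ, W ν ≤ Real.exp (-Real.pi * ν * x ^ 2) * U μ := by
    intro ν hν
    have h1 := hmono (show ν ∈ Set.Ioi 0 from hν.1) (show μ ∈ Set.Ioi 0 from hμ) hν.2.le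
    refine le_trans ?_ (mul_le_mul_of_nonneg_left h1 (Real.exp_pos _).le)
    rw [hU', ← mul_assoc, ← Real.exp_add]
    rw [show -Real.pi * ν * x ^ 2 + Real.pi * ν * x ^ 2 = 0 by ring, Real.exp_zero, one_mul]
    have h2 := tsum_gaussian_alternating_ge hν.1
    have h3 : ∑' n : ℕ, Real.exp (-Real.pi * ν * (n + 1) ^ 2) * c n =
        2 / x * ∑' n : ℕ, Real.exp (-Real.pi * ν * (n + 1) ^ 2) * (-1) ^ (n + 1) -
        ∑' n : ℕ, Real.exp (-Real.pi * ν * (n + 1) ^ 2) *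
      ((-1 : ℝ) ^ (n + 1) * (2 * x / (x ^ 2 - ((n : ℝ) + 1) ^ 2))) := by
      rw [← tsum_mul_left, ← Summable.tsum_sub]
      · refine tsum_congr fun n => ?_
        have := hd n
        simp only [hc, pow_succ]
        field_simp
        ring
      · exact (summable_gaussian_succ_mul hν.1 0 (C := 1) fun n => by simp).mul_left _
      · exact hcos.summable.abs.of_norm_bounded (hbdW ν hν.1)
    rw [h3]
    have h4 : -(1 / x) ≤
        2 / x * ∑' n : ℕ, Real.exp (-Real.pi * ν * (n + 1) ^ 2) * (-1) ^ (n + 1) := by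
      calc -(1 / x) = 2 / x * (-(1 / 2)) := by ring
        _ ≤ _ := mul_le_mul_of_nonneg_left h2 (by positivity)
    simp only [hW]
    linarith
  have hlimW : Tendsto W (𝓝[>] 0) (𝓝 0) := by
    have e0 : Real.pi * Real.exp (-Real.pi * 0 * x ^ 2) / Real.sin (Real.pi * x) -
      1 / x - ∑' n : ℕ, ((-1 : ℝ) ^ (n + 1) * (2 * x / (x ^ 2 - ((n : ℝ) + 1) ^ 2))) = 0 := by
      rw [hcos.tsum_eq]; simp
    have hconv : ∀ c, c = 0 → Tendsto W (𝓝[>] 0) (𝓝 c) → Tendsto W (𝓝[>] 0) (𝓝 0) := by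
      rintro c rfl h
      exact h
    refine hconv _ e0 (Tendsto.sub (Tendsto.sub ?_ tendsto_const_nhds) ?_)
    · refine Tendsto.mono_left (Continuous.tendsto ?_ 0) nhdsWithin_le_nhds
      fun_prop
    · refine tendsto_tsum_of_dominated_convergence hcos.summable.abs (fun n => ?_) ?_
      · have : Continuous fun ν : ℝ => Real.exp (-Real.pi * ν * (n + 1) ^ 2) *
          ((-1 : ℝ) ^ (n + 1) * (2 * x / (x ^ 2 - ((n : ℝ) + 1) ^ 2))) := by fun_prop
        simpa using (this.tendsto 0).mono_left nhdsWithin_le_nhds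
      · exact eventually_nhdsWithin_of_forall fun ν hν => hbdW ν hν
  have hlimU : Tendsto (fun ν => Real.exp (-Real.pi * ν * x ^ 2) * U μ) (𝓝[>] 0) (𝓝 (U μ)) := by
    have : Continuous fun ν : ℝ => Real.exp (-Real.pi * ν * x ^ 2) * U μ := by fun_prop
    simpa using (this.tendsto 0).mono_left nhdsWithin_le_nhds
  have hfin : 0 ≤ U μ := by
    refine le_of_tendsto_of_tendsto hlimW hlimU ?_
    filter_upwards [Ioo_mem_nhdsGT hμ] with ν hν using hlow ν hν
  rw [hU'] at hfin
  exact nonneg_of_mul_nonneg_right hfin (Real.exp_pos _)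

/-! ### The interpolant: entire extension, interpolation and sign property. -/

/-- The entire function `sin w / w`. -/
def complexSinc : ℂ → ℂ := dslope Complex.sin 0

lemma complexSinc_zero : complexSinc 0 = 1 := by
  simp [complexSinc, dslope_same]

lemma complexSinc_of_ne_zero {w : ℂ} (hw : w ≠ 0) : complexSinc w = Complex.sin w / w := by
  simp [complexSinc, dslope_of_ne _ hw, slope_def_field]

lemma differentiable_complexSinc : Differentiable ℂ complexSinc := by
  rw [← differentiableOn_univ, complexSinc, Complex.differentiableOn_dslope univ_mem,
    differentiableOn_univ]
  exact Complex.differentiable_sin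

lemma complexSinc_ofReal (x : ℝ) : complexSinc x = (Real.sinc x : ℂ) := by
  by_cases hx : x = 0
  · simp [hx, complexSinc_zero]
  · rw [complexSinc_of_ne_zero (by exact_mod_cast hx), Real.sinc_of_ne_zero hx]
    push_cast
    rfl

lemma norm_complex_sin_le (w : ℂ) : ‖Complex.sin w‖ ≤ Real.exp |w.im| := by
  rw [Complex.sin, norm_div, norm_mul, Complex.norm_I, mul_one, Complex.norm_ofNat,
    div_le_iff₀ two_pos]
  refine (norm_sub_le _ _).trans ?_
  rw [Complex.norm_exp, Complex.norm_exp]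
  have h1 : (-w * Complex.I).re ≤ |w.im| := by simpa using le_abs_self w.im
  have h2 : (w * Complex.I).re ≤ |w.im| := by simpa using neg_le_abs w.im
  have := Real.exp_le_exp.2 h1
  have := Real.exp_le_exp.2 h2
  linarith

lemma exists_norm_complexSinc_le :
    ∃ C : ℝ, 0 < C ∧ ∀ w, ‖complexSinc w‖ ≤ C * Real.exp |w.im| := by
  obtain ⟨C, hC⟩ := (isCompact_closedBall (0 : ℂ) 1).exists_bound_of_continuousOn
    differentiable_complexSinc.continuous.continuousOn
  refine ⟨max C 1, by positivity, fun w => ?_⟩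
  have he : 1 ≤ Real.exp |w.im| := Real.one_le_exp (abs_nonneg _)
  rcases le_or_gt ‖w‖ 1 with h | h
  · have := hC w (by simpa using h)
    calc ‖complexSinc w‖ ≤ max C 1 * 1 := by rw [mul_one]; exact this.trans (le_max_left _ _)
      _ ≤ _ := mul_le_mul_of_nonneg_left he (by positivity)
  · have hw : w ≠ 0 := by rintro rfl; simp at h; linarith
    rw [complexSinc_of_ne_zero hw, norm_div, div_le_iff₀ (by linarith)]
    calc ‖Complex.sin w‖ ≤ 1 * Real.exp |w.im| * 1 := by
          rw [one_mul, mul_one]; exact norm_complex_sin_le w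
      _ ≤ _ := by gcongr; exact le_max_right _ _

/-- The summands of the interpolation series, with the singularities removed. -/
def interpolantTerm (lam : ℝ) (n : ℕ) (z : ℂ) : ℂ :=
  (Real.exp (-Real.pi * lam * (n + 1) ^ 2) : ℂ) *
    (complexSinc (Real.pi * (z - (n + 1))) - (-1) ^ (n + 1) * complexSinc (Real.pi * z))

lemma summable_gaussian_nat {lam : ℝ} (hlam : 0 < lam) :
    Summable fun n : ℕ => Real.exp (-Real.pi * lam * (n + 1) ^ 2) := by
  simpa using summable_gaussian_succ hlam 0

lemma exists_norm_interpolantTerm_le (lam : ℝ) : ∃ C : ℝ, 0 < C ∧ ∀ n z,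
    ‖interpolantTerm lam n z‖ ≤
      C * Real.exp (Real.pi * |z.im|) * Real.exp (-Real.pi * lam * (n + 1) ^ 2) := by
  obtain ⟨C, hC, hb⟩ := exists_norm_complexSinc_le
  refine ⟨2 * C, by positivity, fun n z => ?_⟩
  have h1 := hb (Real.pi * (z - (n + 1)))
  have h2 := hb (Real.pi * z)
  have e1 : |((Real.pi : ℂ) * (z - (n + 1))).im| = Real.pi * |z.im| := by
    simp [abs_mul, abs_of_pos Real.pi_pos]
  have e2 : |((Real.pi : ℂ) * z).im| = Real.pi * |z.im| := by
    simp [abs_mul, abs_of_pos Real.pi_pos]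
  rw [e1] at h1
  rw [e2] at h2
  rw [interpolantTerm, norm_mul, Complex.norm_real, Real.norm_eq_abs, Real.abs_exp, mul_comm]
  refine mul_le_mul_of_nonneg_right ((norm_sub_le _ _).trans ?_) (Real.exp_pos _).le
  rw [norm_mul, norm_pow, norm_neg, norm_one, one_pow, one_mul]
  linarith

lemma isExpTypeAtMost_tsum_interpolantTerm {lam : ℝ} (hlam : 0 < lam) :
    IsExpTypeAtMost Real.pi fun z => ∑' n, interpolantTerm lam n z := by
  obtain ⟨C, hC, hb⟩ := exists_norm_interpolantTerm_le lam
  have hs := summable_gaussian_nat hlam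
  constructor
  · intro z
    have hopen : IsOpen {w : ℂ | |w.im| < |z.im| + 1} :=
      isOpen_lt (continuous_abs.comp Complex.continuous_im) continuous_const
    refine (Complex.differentiableOn_tsum_of_summable_norm
      (hs.mul_left (C * Real.exp (Real.pi * (|z.im| + 1)))) (fun n => ?_) hopen
      fun n w hw => (hb n w).trans ?_).differentiableAt (hopen.mem_nhds ?_)
    · have h := differentiable_complexSinc
      unfold interpolantTerm
      fun_prop
    · have hw' : |w.im| ≤ |z.im| + 1 := le_of_lt hw
      have := Real.pi_pos
      gcongr
    · simp
  · intro ε hε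
    refine ⟨C * ∑' n : ℕ, Real.exp (-Real.pi * lam * (n + 1) ^ 2),
      mul_pos hC (hs.tsum_pos (fun _ => (Real.exp_pos _).le) 0 (Real.exp_pos _)), fun z => ?_⟩
    have h1 := tsum_of_norm_bounded (hs.mul_left (C * Real.exp (Real.pi * |z.im|))).hasSum
      (fun n => hb n z)
    refine h1.trans ?_
    rw [tsum_mul_left, mul_right_comm]
    have h2 := Complex.abs_im_le_norm z
    have h3 : 0 ≤ ∑' n : ℕ, Real.exp (-Real.pi * lam * (n + 1) ^ 2) :=
      tsum_nonneg fun _ => (Real.exp_pos _).le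
    gcongr
    nlinarith [Real.pi_pos, norm_nonneg z]

lemma sin_pi_mul_sub_succ (z : ℂ) (n : ℕ) :
    Complex.sin (Real.pi * (z - (n + 1))) = (-1) ^ (n + 1) * Complex.sin (Real.pi * z) := by
  have := Complex.sin_antiperiodic.sub_nat_mul_eq (x := Real.pi * z) (n + 1)
  push_cast at this
  rw [← this]
  ring_nf

/-- Because `sin (π(z-m)) = (-1)^m sin (πz)`, the prefactor can be absorbed into each summand, where
it removes the poles. -/
lemma interpolationSeries_eq {lam : ℝ} {z : ℂ} (hz : ∀ n : ℕ, z ≠ n) :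
    interpolationSeries lam z = ∑' n, interpolantTerm lam n z := by
  rw [interpolationSeries, ← tsum_mul_left]
  refine tsum_congr fun n => ?_
  have h0 : z ≠ 0 := by simpa using hz 0
  have h1 : z - (n + 1) ≠ 0 := by
    rw [sub_ne_zero]
    simpa using hz (n + 1)
  have hp : (Real.pi : ℂ) ≠ 0 := by exact_mod_cast Real.pi_ne_zero
  have hg : gaussianC lam (n + 1) = (Real.exp (-Real.pi * lam * (n + 1) ^ 2) : ℂ) := by
    rw [gaussianC]
    push_cast
    rfl
  rw [interpolantTerm, complexSinc_of_ne_zero (mul_ne_zero hp h1),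
    complexSinc_of_ne_zero (mul_ne_zero hp h0), sin_pi_mul_sub_succ, hg]
  field_simp

/-- Only finitely many natural numbers lie in the ball of radius `‖z‖ + 1`, and those other than `z`
form a closed set missing `z`. -/
lemma eventually_forall_ne_natCast (z : ℂ) : ∀ᶠ w : ℂ in 𝓝[≠] z, ∀ n : ℕ, w ≠ n := by
  have hfin : (((fun n : ℕ => (n : ℂ)) '' Set.Iic ⌈‖z‖ + 1⌉₊) \ {z}).Finite :=
    ((Set.finite_Iic _).image _).subset Set.sdiff_subset
  have h1 : ∀ᶠ w : ℂ in 𝓝 z, w ∉ ((fun n : ℕ => (n : ℂ)) '' Set.Iic ⌈‖z‖ + 1⌉₊) \ {z} :=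
    hfin.isClosed.isOpen_compl.mem_nhds (by simp)
  have h2 : ∀ᶠ w in 𝓝 z, ‖w‖ < ‖z‖ + 1 :=
    continuous_norm.continuousAt.eventually_lt continuousAt_const (by simp)
  filter_upwards [nhdsWithin_le_nhds h1, nhdsWithin_le_nhds h2, self_mem_nhdsWithin]
    with w h1 h2 h3 n hn
  refine h1 ⟨⟨n, ?_, hn.symm⟩, h3⟩
  rw [hn, Complex.norm_natCast] at h2
  exact_mod_cast h2.le.trans (Nat.le_ceil _)

lemma interpolant_eq {lam : ℝ} (hlam : 0 < lam) (z : ℂ) :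
    interpolant lam z = ∑' n, interpolantTerm lam n z := by
  refine Tendsto.limUnder_eq (Tendsto.congr' ?_
    ((isExpTypeAtMost_tsum_interpolantTerm hlam).entire.continuous.continuousAt.tendsto.mono_left
      nhdsWithin_le_nhds))
  filter_upwards [eventually_forall_ne_natCast z] with w hw using (interpolationSeries_eq hw).symm

lemma isExpTypeAtMost_interpolant {lam : ℝ} (hlam : 0 < lam) :
    IsExpTypeAtMost Real.pi (interpolant lam) := by
  rw [show interpolant lam = _ from funext (interpolant_eq hlam)]
  exact isExpTypeAtMost_tsum_interpolantTerm hlam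

lemma complexSinc_pi_mul_int {m : ℤ} (hm : m ≠ 0) : complexSinc (Real.pi * m) = 0 := by
  have hp : (Real.pi : ℂ) ≠ 0 := by exact_mod_cast Real.pi_ne_zero
  rw [complexSinc_of_ne_zero (mul_ne_zero hp (by exact_mod_cast hm)), mul_comm,
    Complex.sin_int_mul_pi, zero_div]

lemma interpolant_intCast {lam : ℝ} (hlam : 0 < lam) {m : ℤ} (hm : m ≠ 0) :
    interpolant lam m = (truncGaussian lam m : ℂ) := by
  rw [interpolant_eq hlam]
  have hterm : ∀ n : ℕ, (m ≠ n + 1) → interpolantTerm lam n m = 0 := by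
    intro n hn
    have h := complexSinc_pi_mul_int (m := m - (n + 1)) (sub_ne_zero.2 hn)
    push_cast at h
    rw [interpolantTerm, h, complexSinc_pi_mul_int hm]
    simp
  rcases lt_or_gt_of_ne hm with h | h
  · rw [tsum_congr fun n => hterm n (by omega)]
    have : (m : ℝ) < 0 := by exact_mod_cast h
    simp [truncGaussian, truncZero, Real.sign_of_neg this]
  · obtain ⟨k, rfl⟩ : ∃ k : ℕ, m = k + 1 := ⟨(m - 1).toNat, by omega⟩
    rw [tsum_eq_single k fun n hn => hterm n (by omega), interpolantTerm,
      complexSinc_pi_mul_int hm]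
    have : (0 : ℝ) < ((k + 1 : ℤ) : ℝ) := by exact_mod_cast h
    rw [truncGaussian, truncZero, Real.sign_of_pos this]
    push_cast
    simp [complexSinc_zero]

lemma interpolantTerm_ofReal (lam : ℝ) (n : ℕ) (x : ℝ) :
    interpolantTerm lam n x = ((Real.exp (-Real.pi * lam * (n + 1) ^ 2) *
      (Real.sinc (Real.pi * (x - (n + 1))) - (-1) ^ (n + 1) * Real.sinc (Real.pi * x)) : ℝ) : ℂ) := by
  rw [interpolantTerm]
  push_cast
  rw [← complexSinc_ofReal, ← complexSinc_ofReal]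
  push_cast
  rfl

lemma interpolant_ofReal {lam : ℝ} (hlam : 0 < lam) (x : ℝ) :
    interpolant lam x = ((∑' n : ℕ, Real.exp (-Real.pi * lam * (n + 1) ^ 2) *
      (Real.sinc (Real.pi * (x - (n + 1))) - (-1) ^ (n + 1) * Real.sinc (Real.pi * x)) : ℝ) : ℂ) := by
  rw [interpolant_eq hlam, Complex.ofReal_tsum]
  exact tsum_congr fun n => interpolantTerm_ofReal lam n x

lemma interpolant_im {lam : ℝ} (hlam : 0 < lam) (x : ℝ) : (interpolant lam x).im = 0 := by
  rw [interpolant_ofReal hlam, Complex.ofReal_im]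

/-- This is `1/(x-m) - 1/x = m/(x(x-m))`. The extra factor `1/x` makes the interpolant integrable on
the real line. -/
lemma sinc_sub_sinc_eq {x : ℝ} (hx0 : x ≠ 0) (n : ℕ) :
    Real.sinc (Real.pi * (x - (n + 1))) - (-1) ^ (n + 1) * Real.sinc (Real.pi * x) =
      (n + 1) / x * Real.sinc (Real.pi * (x - (n + 1))) := by
  have hp := Real.pi_ne_zero
  have hs : Real.sin (Real.pi * (x - (n + 1))) = (-1) ^ (n + 1) * Real.sin (Real.pi * x) := by
    rw [← Real.sin_sub_nat_mul_pi]
    push_cast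
    ring_nf
  by_cases h : x - (n + 1) = 0
  · rw [sub_eq_zero] at h
    have h' : Real.sin (Real.pi * x) = 0 := by
      rw [h, mul_comm]
      exact_mod_cast Real.sin_nat_mul_pi (n + 1)
    rw [Real.sinc_of_ne_zero (mul_ne_zero hp hx0), h', h]
    simp
    field_simp
  · rw [Real.sinc_of_ne_zero (mul_ne_zero hp h), Real.sinc_of_ne_zero (mul_ne_zero hp hx0), hs]
    field_simp
    ring

lemma interpolant_re_eq {lam : ℝ} (hlam : 0 < lam) {x : ℝ} (hx : ∀ n : ℤ, x ≠ n) :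
    (interpolant lam x).re = -(Real.sin (Real.pi * x) / Real.pi *
      ∑' n : ℕ, Real.exp (-Real.pi * lam * (n + 1) ^ 2) *
        ((-1) ^ n * (((n : ℝ) + 1) / (x * (x - (n + 1)))))) := by
  have hp := Real.pi_ne_zero
  have hx0 : x ≠ 0 := by simpa using hx 0
  rw [interpolant_ofReal hlam, Complex.ofReal_re, ← neg_mul, ← tsum_mul_left]
  refine tsum_congr fun n => ?_
  have h : x - (n + 1) ≠ 0 := by
    rw [sub_ne_zero]
    have := hx (n + 1)
    push_cast at this
    exact this
  have hs : Real.sin (Real.pi * (x - (n + 1))) = (-1) ^ (n + 1) * Real.sin (Real.pi * x) := by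
    rw [← Real.sin_sub_nat_mul_pi]
    push_cast
    ring_nf
  rw [sinc_sub_sinc_eq hx0, Real.sinc_of_ne_zero (mul_ne_zero hp h), hs]
  field_simp
  ring

/-- The truncated Gaussian minus its interpolant has the sign of `sin (π x)`. -/
lemma sin_mul_sub_interpolant_nonneg {lam : ℝ} (hlam : 0 < lam) (x : ℝ) :
    0 ≤ Real.sin (Real.pi * x) * (truncGaussian lam x - (interpolant lam x).re) := by
  by_cases hx : ∀ n : ℤ, x ≠ n
  swap
  · push Not at hx
    obtain ⟨n, rfl⟩ := hx
    rw [mul_comm Real.pi, Real.sin_int_mul_pi, zero_mul]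
  have hs := sin_pi_mul_ne_zero_of_forall hx
  have hx0 : x ≠ 0 := by simpa using hx 0
  rw [interpolant_re_eq hlam hx]
  rcases lt_or_gt_of_ne hx0 with hneg | hpos
  · have ht : 0 < -x := neg_pos.2 hneg
    have hE := tsum_gaussian_alternating_div_nonneg hlam ht
    have e : ∑' n : ℕ, Real.exp (-Real.pi * lam * (n + 1) ^ 2) *
        ((-1) ^ n * (((n : ℝ) + 1) / (x * (x - (n + 1))))) = 1 / (-x) *
        ∑' n : ℕ, Real.exp (-Real.pi * lam * (n + 1) ^ 2) *
          ((-1) ^ n * (((n : ℝ) + 1) / (-x + (n + 1)))) := by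
      rw [← tsum_mul_left]
      refine tsum_congr fun n => ?_
      have h1 : x - (n + 1) ≠ 0 := by
        have : (0 : ℝ) < n + 1 := by positivity
        linarith
      rw [show -x + (n + 1) = -(x - (n + 1)) by ring]
      field_simp
    rw [e, truncGaussian, truncZero, Real.sign_of_neg hneg]
    have : 0 ≤ Real.sin (Real.pi * x) ^ 2 / Real.pi * (1 / (-x) *
        ∑' n : ℕ, Real.exp (-Real.pi * lam * (n + 1) ^ 2) *
          ((-1) ^ n * (((n : ℝ) + 1) / (-x + (n + 1))))) := by positivity
    refine this.trans_eq ?_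
    ring
  -- For `x > 0`, `m/(x-m) = 2m²/(x²-m²) + m/(x+m)` separates the even part `hV` from the sum `hE`
  -- already used for negative `x`. The Gaussian itself joins the even part as its cosecant term.
  · have hE := tsum_gaussian_alternating_div_nonneg hlam hpos
    have hV := tsum_gaussian_even_part_nonneg hlam hpos hx
    have hd := sq_sub_sq_ne_zero hx
    obtain ⟨C, hC, hCn⟩ := exists_abs_inv_sq_sub_sq_le hx
    have e : ∑' n : ℕ, Real.exp (-Real.pi * lam * (n + 1) ^ 2) *
        ((-1) ^ n * (((n : ℝ) + 1) / (x * (x - (n + 1))))) =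
        (∑' n : ℕ, Real.exp (-Real.pi * lam * (n + 1) ^ 2) *
        ((-1) ^ n * (2 * ((n : ℝ) + 1) ^ 2 / (x * (x ^ 2 - ((n : ℝ) + 1) ^ 2))))) + 1 / x *
        ∑' n : ℕ, Real.exp (-Real.pi * lam * (n + 1) ^ 2) *
          ((-1) ^ n * (((n : ℝ) + 1) / (x + (n + 1)))) := by
      rw [← tsum_mul_left, ← Summable.tsum_add]
      · refine tsum_congr fun n => ?_
        have h1 := hd n
        rw [sq_sub_sq] at h1 ⊢
        have h2 := left_ne_zero_of_mul h1
        have h3 := right_ne_zero_of_mul h1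
        field_simp
        ring
      · refine summable_gaussian_succ_mul hlam 2 (C := 2 / x * C) fun n => ?_
        rw [show 2 * ((n : ℝ) + 1) ^ 2 / (x * (x ^ 2 - ((n : ℝ) + 1) ^ 2)) =
          2 / x * ((n : ℝ) + 1) ^ 2 * (1 / (x ^ 2 - ((n : ℝ) + 1) ^ 2)) by
            have := hd n
            field_simp, abs_mul, abs_pow, abs_neg, abs_one, one_pow,
          one_mul, abs_mul, abs_of_nonneg (show 0 ≤ 2 / x * ((n : ℝ) + 1) ^ 2 by positivity),
          mul_right_comm]
        exact mul_le_mul_of_nonneg_right (mul_le_mul_of_nonneg_left (hCn n) (by positivity))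
          (by positivity)
      · refine (summable_gaussian_succ_mul hlam 0 (C := 1) fun n => ?_).mul_left _
        rw [abs_mul, abs_pow, abs_neg, abs_one, one_pow, one_mul, abs_of_nonneg (by positivity),
          pow_zero, mul_one, div_le_one (by positivity)]
        linarith
    rw [e, truncGaussian, truncZero, Real.sign_of_pos hpos]
    have : 0 ≤ Real.sin (Real.pi * x) ^ 2 / Real.pi *
        ((Real.pi * Real.exp (-Real.pi * lam * x ^ 2) / Real.sin (Real.pi * x) +
        (∑' n : ℕ, Real.exp (-Real.pi * lam * (n + 1) ^ 2) *
        ((-1) ^ n * (2 * ((n : ℝ) + 1) ^ 2 / (x * (x ^ 2 - ((n : ℝ) + 1) ^ 2)))))) + 1 / x *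
        ∑' n : ℕ, Real.exp (-Real.pi * lam * (n + 1) ^ 2) *
          ((-1) ^ n * (((n : ℝ) + 1) / (x + (n + 1))))) := by positivity
    refine this.trans_eq ?_
    have hp := Real.pi_ne_zero
    field_simp
    ring_nf

/-! ### Growth in the upper half-plane and the Paley–Wiener vanishing theorem. -/

/-- The Phragmén–Lindelöf bound in the upper half-plane for a function of exponential type that
is bounded on the real line. -/
lemma IsExpTypeAtMost.norm_le_of_bounded_on_real {σ : ℝ} {F : ℂ → ℂ} (hF : IsExpTypeAtMost σ F)
    {M : ℝ} (hM : ∀ x : ℝ, ‖F x‖ ≤ M) {z : ℂ} (hz : 0 ≤ z.im) :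
    ‖F z‖ ≤ M * Real.exp (σ * z.im) := by
  have key : ∀ ε : ℝ, 0 < ε → ‖F z‖ ≤ M * Real.exp ((σ + ε) * z.im) := by
    intro ε hε
    obtain ⟨C, hC, hg⟩ := hF.growth ε hε
    -- The rotation `w ↦ iw` carries the right half-plane to the upper one, and the exponential
    -- factor makes `f` bounded on the positive real axis, as the half-plane principle requires. The
    -- loss `ε` is removed at the end.
    set f : ℂ → ℂ := fun w => F (Complex.I * w) * Complex.exp (-((σ + ε : ℝ) : ℂ) * w) with hf
    have hfn : ∀ w, ‖f w‖ = ‖F (Complex.I * w)‖ * Real.exp (-(σ + ε) * w.re) := by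
      intro w
      rw [hf, norm_mul, Complex.norm_exp, ← Complex.ofReal_neg, Complex.re_ofReal_mul]
    have hbd : ∀ w, ‖F (Complex.I * w)‖ ≤ C * Real.exp ((σ + ε) * ‖w‖) := by
      intro w
      simpa using hg (Complex.I * w)
    have hfd : Differentiable ℂ f := by
      have := hF.entire
      fun_prop
    have h := PhragmenLindelof.right_half_plane_of_bounded_on_real (f := f) (C := M)
      (z := -Complex.I * z) hfd.diffContOnCl ?_ ?_ ?_ (by simpa using hz)
    · rw [hfn, ← mul_assoc] at h
      simp only [mul_neg, neg_mul, Complex.I_mul_I, neg_neg, one_mul, Complex.neg_re,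
        Complex.I_mul_re] at h
      calc ‖F z‖ = ‖F z‖ * Real.exp (-((σ + ε) * z.im)) * Real.exp ((σ + ε) * z.im) := by
            rw [mul_assoc, ← Real.exp_add]; simp
        _ ≤ _ := mul_le_mul_of_nonneg_right h (Real.exp_pos _).le
    · refine ⟨1, one_lt_two, |σ + ε| + |σ + ε|, Asymptotics.IsBigO.of_bound C ?_⟩
      refine Eventually.of_forall fun w => ?_
      rw [hfn, Real.rpow_one, Real.norm_eq_abs, Real.abs_exp, add_mul, Real.exp_add, ← mul_assoc]
      have h1 : (σ + ε) * ‖w‖ ≤ |σ + ε| * ‖w‖ :=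
        mul_le_mul_of_nonneg_right (le_abs_self _) (norm_nonneg _)
      have h2 : -(σ + ε) * w.re ≤ |σ + ε| * ‖w‖ := by
        refine (le_abs_self _).trans ?_
        rw [abs_mul, abs_neg]
        exact mul_le_mul_of_nonneg_left (Complex.abs_re_le_norm w) (abs_nonneg _)
      exact mul_le_mul ((hbd w).trans (mul_le_mul_of_nonneg_left (Real.exp_le_exp.2 h1) hC.le))
        (Real.exp_le_exp.2 h2) (Real.exp_pos _).le (by positivity)
    · refine isBoundedUnder_of_eventually_le (a := C) ?_
      filter_upwards [eventually_ge_atTop 0] with x hx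
      have := hbd x
      rw [Complex.norm_real, Real.norm_eq_abs, abs_of_nonneg hx] at this
      rw [hfn, Complex.ofReal_re]
      calc _ ≤ C * Real.exp ((σ + ε) * x) * Real.exp (-(σ + ε) * x) :=
            mul_le_mul_of_nonneg_right this (Real.exp_pos _).le
        _ = C := by
            rw [mul_assoc, ← Real.exp_add, ← add_mul, add_neg_cancel, zero_mul, Real.exp_zero,
              mul_one]
    · intro y
      rw [hfn]
      have := hM (-y)
      have e : Complex.I * (y * Complex.I) = ((-y : ℝ) : ℂ) := by
        rw [mul_left_comm, Complex.I_mul_I]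
        simp
      rw [e]
      simpa using this
  have hlim : Tendsto (fun ε : ℝ => M * Real.exp ((σ + ε) * z.im)) (𝓝[>] 0)
      (𝓝 (M * Real.exp (σ * z.im))) := by
    have : Continuous fun ε : ℝ => M * Real.exp ((σ + ε) * z.im) := by fun_prop
    simpa using (this.tendsto 0).mono_left nhdsWithin_le_nhds
  exact ge_of_tendsto hlim (eventually_nhdsWithin_of_forall fun ε hε => key ε hε)

/-- Closing the contour in the upper half-plane. -/
lemma integral_div_sq_eq_zero {f : ℂ → ℂ} (hf : Differentiable ℂ f) {M : ℝ}
    (hM : ∀ z : ℂ, 0 ≤ z.im → ‖f z‖ ≤ M) {δ : ℝ} (hδ : 0 < δ) :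
    ∫ x : ℝ, f x / (1 - Complex.I * δ * x) ^ 2 = 0 := by
  have hM0 : 0 ≤ M := (norm_nonneg _).trans (hM 0 (by simp))
  set F : ℂ → ℂ := fun z => f z / (1 - Complex.I * δ * z) ^ 2 with hF
  have hre : ∀ z : ℂ, (1 - Complex.I * δ * z).re = 1 + δ * z.im := by
    intro z; simp
  have him : ∀ z : ℂ, (1 - Complex.I * δ * z).im = -(δ * z.re) := by
    intro z; simp
  have hnorm : ∀ z : ℂ, ‖(1 - Complex.I * δ * z) ^ 2‖ = (1 + δ * z.im) ^ 2 + (δ * z.re) ^ 2 := by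
    intro z
    rw [norm_pow, ← Complex.normSq_eq_norm_sq, Complex.normSq_apply, hre, him]
    ring
  have hne : ∀ z : ℂ, 0 ≤ z.im → 1 - Complex.I * δ * z ≠ 0 := by
    intro z hz h
    have := hre z
    rw [h, Complex.zero_re] at this
    have : 0 ≤ δ * z.im := by positivity
    linarith
  have hFd : ∀ z : ℂ, 0 ≤ z.im → DifferentiableAt ℂ F z := by
    intro z hz
    exact (hf z).div (by fun_prop) (pow_ne_zero 2 (hne z hz))
  have hFb : ∀ z : ℂ, 0 ≤ z.im → ‖F z‖ ≤ M / ((1 + δ * z.im) ^ 2 + (δ * z.re) ^ 2) := by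
    intro z hz
    rw [hF, norm_div, hnorm]
    exact div_le_div_of_nonneg_right (hM z hz) (by positivity)
  have hFc : Continuous fun x : ℝ => F x := by
    refine continuous_iff_continuousAt.2 fun x => ?_
    exact ((hFd x (by simp)).continuousAt).comp Complex.continuous_ofReal.continuousAt
  have hint : Integrable fun x : ℝ => F x := by
    have h1 : Integrable fun x : ℝ => M * (1 + (δ * x) ^ 2)⁻¹ :=
      (integrable_inv_one_add_sq.comp_mul_left' hδ.ne').const_mul M
    refine h1.mono' hFc.aestronglyMeasurable (Eventually.of_forall fun x => ?_)
    simpa [div_eq_mul_inv] using hFb x (by simp)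
  -- On the other three sides of the rectangle the denominator is at least `(δT)²` and their total
  -- length is `4T`, so they contribute `O(1/T)`.
  have hrect : ∀ T : ℝ, 0 < T → ‖∫ x in (-T)..T, F x‖ ≤ 4 * M / δ ^ 2 * T⁻¹ := by
    intro T hT
    have h := Complex.integral_boundary_rect_eq_zero_of_differentiableOn F (-T) (T + T * Complex.I)
      (fun z hz => (hFd z ?_).differentiableWithinAt)
    · simp only [Complex.neg_re, Complex.ofReal_re, Complex.add_re, Complex.mul_re, Complex.I_re,
        Complex.ofReal_im, Complex.I_im, Complex.neg_im, Complex.add_im, Complex.mul_im, mul_zero,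
        mul_one, zero_mul, neg_zero, sub_zero, add_zero, zero_add, Complex.ofReal_zero,
        smul_eq_mul] at h
      have b1 : ‖∫ x in (-T)..T, F (x + T * Complex.I)‖ ≤ M / (δ * T) ^ 2 * |T - -T| := by
        refine intervalIntegral.norm_integral_le_of_norm_le_const fun x _ => ?_
        refine (hFb _ (by simpa using hT.le)).trans ?_
        refine div_le_div_of_nonneg_left hM0 (by positivity) ?_
        simp
        nlinarith [sq_nonneg (δ * x), mul_pos hδ hT]
      have b2 : ‖∫ y in (0 : ℝ)..T, F (T + y * Complex.I)‖ ≤ M / (δ * T) ^ 2 * |T - 0| := by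
        refine intervalIntegral.norm_integral_le_of_norm_le_const fun y hy => ?_
        rw [Set.uIoc_of_le hT.le] at hy
        refine (hFb _ (by simpa using hy.1.le)).trans ?_
        refine div_le_div_of_nonneg_left hM0 (by positivity) ?_
        simp
        positivity
      have b3 : ‖∫ y in (0 : ℝ)..T, F (((-T : ℝ) : ℂ) + y * Complex.I)‖ ≤
          M / (δ * T) ^ 2 * |T - 0| := by
        refine intervalIntegral.norm_integral_le_of_norm_le_const fun y hy => ?_
        rw [Set.uIoc_of_le hT.le] at hy
        refine (hFb _ (by simpa using hy.1.le)).trans ?_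
        refine div_le_div_of_nonneg_left hM0 (by positivity) ?_
        simp
        positivity
      rw [sub_neg_eq_add, abs_of_pos (by positivity)] at b1
      rw [sub_zero, abs_of_pos hT] at b2 b3
      have e : ∫ x in (-T)..T, F x = (∫ x in (-T)..T, F (x + T * Complex.I)) -
          Complex.I * (∫ y in (0 : ℝ)..T, F (T + y * Complex.I)) +
          Complex.I * (∫ y in (0 : ℝ)..T, F (((-T : ℝ) : ℂ) + y * Complex.I)) := by
        linear_combination h
      rw [e]
      refine (norm_add_le _ _).trans ((add_le_add_left (norm_sub_le _ _) _).trans ?_)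
      rw [norm_mul, norm_mul, Complex.norm_I, one_mul, one_mul]
      calc _ ≤ M / (δ * T) ^ 2 * (T + T) + M / (δ * T) ^ 2 * T + M / (δ * T) ^ 2 * T := by
            gcongr
        _ = _ := by field_simp; ring
    · have := hz.2
      simp [Set.uIcc_of_le hT.le] at this
      exact this.1
  have hlim := intervalIntegral_tendsto_integral hint tendsto_neg_atTop_atBot tendsto_id
  have hlim0 : Tendsto (fun T : ℝ => ∫ x in (-T)..(id T), F x) atTop (𝓝 0) := by
    refine squeeze_zero_norm' ?_ (a := fun T : ℝ => 4 * M / δ ^ 2 * T⁻¹) ?_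
    · filter_upwards [eventually_gt_atTop 0] with T hT using hrect T hT
    · have := (tendsto_inv_atTop_zero (𝕜 := ℝ)).const_mul (4 * M / δ ^ 2)
      rwa [mul_zero] at this
  exact tendsto_nhds_unique hlim hlim0

/-- The average of an entire function over horizontal segments of length `h`. -/
def horizontalMean (h : ℝ) (K : ℂ → ℂ) (z : ℂ) : ℂ := ∫ s in (0 : ℝ)..h, K (z + s)

/-- On a disc `K` has a primitive `g`, and the integral over the segment is `g (w + h) - g w`. -/
lemma differentiable_horizontalMean {K : ℂ → ℂ} (hK : Differentiable ℂ K) {h : ℝ} (hh : 0 ≤ h) :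
    Differentiable ℂ (horizontalMean h K) := by
  intro z
  obtain ⟨g, hg⟩ := (hK.differentiableOn (s := Metric.ball 0 (‖z‖ + h + 1))).isExactOn_ball
  have hmem : ∀ w ∈ Metric.ball z 1, ∀ s ∈ Set.Icc 0 h, w + (s : ℂ) ∈
      Metric.ball (0 : ℂ) (‖z‖ + h + 1) := by
    intro w hw s hs
    rw [mem_ball_zero_iff]
    rw [mem_ball_iff_norm] at hw
    calc ‖w + (s : ℂ)‖ = ‖z + (w - z) + (s : ℂ)‖ := by ring_nf
      _ ≤ ‖z‖ + ‖w - z‖ + ‖(s : ℂ)‖ := norm_add₃_le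
      _ < _ := by
        rw [Complex.norm_real, Real.norm_eq_abs, abs_of_nonneg hs.1]
        linarith [hs.2]
  have heq : ∀ w ∈ Metric.ball z 1, horizontalMean h K w = g (w + h) - g (w + 0) := by
    intro w hw
    rw [horizontalMean, ← Complex.ofReal_zero]
    refine intervalIntegral.integral_eq_sub_of_hasDerivAt (f := fun s : ℝ => g (w + s)) ?_ ?_
    · intro s hs
      rw [Set.uIcc_of_le hh] at hs
      have h1 := hg _ (hmem w hw s hs)
      have h2 : HasDerivAt (fun s : ℝ => w + (s : ℂ)) 1 s :=
        (Complex.ofRealCLM.hasDerivAt).const_add w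
      have h3 := h1.comp s h2
      rw [mul_one] at h3
      exact h3
    · have := hK.continuous
      exact Continuous.intervalIntegrable (by fun_prop) _ _
  have hz := Metric.mem_ball_self (x := z) one_pos
  refine DifferentiableAt.congr_of_eventuallyEq (f := fun w => g (w + h) - g (w + 0)) ?_ ?_
  · have h1 := (hg _ (hmem z hz h ⟨hh, le_rfl⟩)).differentiableAt
    have h2 := (hg _ (hmem z hz 0 ⟨le_rfl, hh⟩)).differentiableAt
    rw [Complex.ofReal_zero] at h2
    exact (h1.comp z (by fun_prop)).sub (h2.comp z (f := fun w => w + 0) (by fun_prop))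
  · filter_upwards [Metric.ball_mem_nhds z one_pos] with w hw using heq w hw

lemma IsExpTypeAtMost.horizontalMean {σ : ℝ} (hσ : 0 ≤ σ) {K : ℂ → ℂ} (hK : IsExpTypeAtMost σ K)
    {h : ℝ} (hh : 0 < h) : IsExpTypeAtMost σ (horizontalMean h K) := by
  refine ⟨differentiable_horizontalMean hK.entire hh.le, fun ε hε => ?_⟩
  obtain ⟨C, hC, hg⟩ := hK.growth ε hε
  refine ⟨C * Real.exp ((σ + ε) * h) * h, by positivity, fun z => ?_⟩
  have : ‖_root_.horizontalMean h K z‖ ≤ C * Real.exp ((σ + ε) * (‖z‖ + h)) * |h - 0| := by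
    refine intervalIntegral.norm_integral_le_of_norm_le_const fun s hs => ?_
    rw [Set.uIoc_of_le hh.le] at hs
    refine (hg _).trans ?_
    have : ‖z + (s : ℂ)‖ ≤ ‖z‖ + h := by
      refine (norm_add_le _ _).trans ?_
      rw [Complex.norm_real, Real.norm_eq_abs, abs_of_pos hs.1]
      linarith [hs.2]
    gcongr
  refine this.trans_eq ?_
  rw [sub_zero, abs_of_pos hh, mul_add, Real.exp_add]
  ring

/-- The point of the horizontal integrals: they are bounded on the real line by the `L¹` norm of
`K`, so Phragmén–Lindelöf applies without first proving `K` itself bounded there. -/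
lemma norm_horizontalMean_le {K : ℂ → ℂ} (hi : Integrable fun x : ℝ => K x) {h : ℝ} (hh : 0 ≤ h)
    (x : ℝ) : ‖horizontalMean h K x‖ ≤ ∫ x : ℝ, ‖K x‖ := by
  rw [horizontalMean, intervalIntegral.integral_of_le hh]
  refine (norm_integral_le_integral_norm _).trans ?_
  have h1 : ∫ s : ℝ, ‖K (x + s)‖ = ∫ s : ℝ, ‖K s‖ := by
    rw [← integral_add_left_eq_self (fun s : ℝ => ‖K s‖) x]
    push_cast
    rfl
  rw [← h1]
  refine setIntegral_le_integral ?_ (Eventually.of_forall fun s => norm_nonneg _)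
  have := (hi.comp_add_left x).norm
  push_cast at this
  exact this

lemma integrable_prod_shift {K : ℂ → ℂ} (hK : Continuous K) (hi : Integrable fun x : ℝ => K x)
    (h : ℝ) : Integrable (fun p : ℝ × ℝ => K (p.1 + p.2))
      (volume.prod (volume.restrict (Set.Ioc 0 h))) := by
  rw [integrable_prod_iff' (by
    refine Continuous.aestronglyMeasurable ?_
    fun_prop)]
  constructor
  · refine Eventually.of_forall fun s => ?_
    have := hi.comp_add_right s
    push_cast at this
    exact this
  · have h1 : ∀ s : ℝ, ∫ x : ℝ, ‖K (x + s)‖ = ∫ x : ℝ, ‖K x‖ := by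
      intro s
      rw [← integral_add_right_eq_self (fun s : ℝ => ‖K s‖) s]
      push_cast
      rfl
    simp only [h1]
    exact integrable_const _

lemma integrable_horizontalMean {K : ℂ → ℂ} (hK : Continuous K)
    (hi : Integrable fun x : ℝ => K x) {h : ℝ} (hh : 0 ≤ h) :
    Integrable fun x : ℝ => horizontalMean h K x := by
  have := (integrable_prod_shift hK hi h).integral_prod_left
  simpa only [horizontalMean, intervalIntegral.integral_of_le hh] using this

lemma integral_horizontalMean_mul_exp {K : ℂ → ℂ} (hK : Continuous K)
    (hi : Integrable fun x : ℝ => K x) {h : ℝ} (hh : 0 ≤ h) (a : ℝ) :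
    ∫ x : ℝ, horizontalMean h K x * Complex.exp (a * x * Complex.I) =
      (∫ s in (0 : ℝ)..h, Complex.exp (-(a * s * Complex.I))) *
        ∫ x : ℝ, K x * Complex.exp (a * x * Complex.I) := by
  have hint : Integrable (fun p : ℝ × ℝ => K (p.1 + p.2) * Complex.exp (a * p.1 * Complex.I))
      (volume.prod (volume.restrict (Set.Ioc 0 h))) := by
    refine (integrable_prod_shift hK hi h).mul_bdd (c := 1) ?_ ?_
    · exact Continuous.aestronglyMeasurable (by fun_prop)
    · refine Eventually.of_forall fun p => ?_
      rw [← Complex.ofReal_mul, Complex.norm_exp_ofReal_mul_I]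
  simp only [horizontalMean, intervalIntegral.integral_of_le hh]
  simp only [← integral_mul_const]
  rw [integral_integral_swap hint]
  refine integral_congr_ae (Eventually.of_forall fun s => ?_)
  simp only
  rw [← integral_const_mul, ← integral_add_right_eq_self _ (-s)]
  refine integral_congr_ae (Eventually.of_forall fun x => ?_)
  simp only
  push_cast
  rw [mul_left_comm, ← Complex.exp_add]
  ring_nf

/-- **Paley–Wiener**: the Fourier transform of an integrable function of exponential type `σ`
vanishes at frequencies `|a| ≥ σ`; the case of positive frequencies. -/
lemma IsExpTypeAtMost.integral_mul_exp_eq_zero_of_le {σ : ℝ} (hσ : 0 < σ) {K : ℂ → ℂ}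
    (hK : IsExpTypeAtMost σ K) (hi : Integrable fun x : ℝ => K x) {a : ℝ} (ha : σ ≤ a) :
    ∫ x : ℝ, K x * Complex.exp (a * x * Complex.I) = 0 := by
  have ha0 : 0 < a := hσ.trans_le ha
  -- With this length the factor `∫₀^h exp (-ias) ds` equals `2/(ia)`, which is not zero, so
  -- vanishing of the transform of the mean gives that of `K`.
  set h := Real.pi / a with hh
  have hh0 : 0 < h := div_pos Real.pi_pos ha0
  set M := ∫ x : ℝ, ‖K x‖ with hM
  have hM0 : 0 ≤ M := integral_nonneg fun _ => norm_nonneg _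
  set L := _root_.horizontalMean h K with hL
  have hLt : IsExpTypeAtMost σ L := hK.horizontalMean hσ.le hh0
  have hLi : Integrable fun x : ℝ => L x := integrable_horizontalMean hK.entire.continuous hi hh0.le
  have hLb : ∀ z : ℂ, 0 ≤ z.im → ‖L z * Complex.exp (a * z * Complex.I)‖ ≤ M := by
    intro z hz
    have h1 := hLt.norm_le_of_bounded_on_real (norm_horizontalMean_le hi hh0.le) hz
    rw [norm_mul, Complex.norm_exp]
    have h2 : (a * z * Complex.I).re = -(a * z.im) := by simp
    rw [h2]
    calc _ ≤ M * Real.exp (σ * z.im) * Real.exp (-(a * z.im)) :=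
          mul_le_mul_of_nonneg_right h1 (Real.exp_pos _).le
      _ = M * Real.exp ((σ - a) * z.im) := by
          rw [mul_assoc, ← Real.exp_add]; ring_nf
      _ ≤ M * 1 := by
          refine mul_le_mul_of_nonneg_left (Real.exp_le_one_iff.2 ?_) hM0
          exact mul_nonpos_of_nonpos_of_nonneg (by linarith) hz
      _ = M := mul_one M
  -- The factor `(1 - iδx)⁻²` supplies the decay needed to close the contour; `δ → 0⁺` then removes
  -- it by dominated convergence.
  have hzero : ∀ δ : ℝ, 0 < δ →
      ∫ x : ℝ, L x * Complex.exp (a * x * Complex.I) / (1 - Complex.I * δ * x) ^ 2 = 0 := by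
    intro δ hδ
    have hd : Differentiable ℂ fun z => L z * Complex.exp (a * z * Complex.I) := by
      have := hLt.entire
      fun_prop
    exact integral_div_sq_eq_zero hd hLb hδ
  have hLe : ∫ x : ℝ, L x * Complex.exp (a * x * Complex.I) = 0 := by
    have hden : ∀ (δ x : ℝ), 1 ≤ ‖(1 - Complex.I * δ * x) ^ 2‖ := by
      intro δ x
      rw [norm_pow, ← Complex.normSq_eq_norm_sq, Complex.normSq_apply]
      simp
      nlinarith [sq_nonneg (δ * x)]
    have hlim : Tendsto (fun δ : ℝ => ∫ x : ℝ,
        L x * Complex.exp (a * x * Complex.I) / (1 - Complex.I * δ * x) ^ 2) (𝓝[>] 0)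
        (𝓝 (∫ x : ℝ, L x * Complex.exp (a * x * Complex.I))) := by
      have hLc := hLt.entire.continuous
      refine tendsto_integral_filter_of_dominated_convergence (fun x => ‖L x‖) ?_ ?_ hLi.norm ?_
      · refine Eventually.of_forall fun δ => Continuous.aestronglyMeasurable ?_
        refine Continuous.div (by fun_prop) (by fun_prop) fun x hx => ?_
        have := hden δ x
        rw [hx, norm_zero] at this
        linarith
      · refine Eventually.of_forall fun δ => Eventually.of_forall fun x => ?_
        rw [norm_div, norm_mul, ← Complex.ofReal_mul a x, Complex.norm_exp_ofReal_mul_I, mul_one]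
        exact div_le_self (norm_nonneg _) (hden δ x)
      · refine Eventually.of_forall fun x => ?_
        have hc : ContinuousAt (fun δ : ℝ => L x * Complex.exp (a * x * Complex.I) /
            (1 - Complex.I * δ * x) ^ 2) 0 := by
          refine ContinuousAt.div (by fun_prop) (by fun_prop) ?_
          simp
        simpa using hc.tendsto.mono_left nhdsWithin_le_nhds
    refine tendsto_nhds_unique (hlim.congr' ?_) tendsto_const_nhds
    exact eventually_nhdsWithin_of_forall fun δ hδ => hzero δ hδ
  rw [hL, integral_horizontalMean_mul_exp hK.entire.continuous hi hh0.le] at hLe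
  refine (mul_eq_zero.1 hLe).resolve_left ?_
  have hc : (-(a * Complex.I) : ℂ) ≠ 0 :=
    neg_ne_zero.2 (mul_ne_zero (by exact_mod_cast ha0.ne') Complex.I_ne_zero)
  have e : ∀ s : ℝ, -((a : ℂ) * s * Complex.I) = -(a * Complex.I) * s := fun s => by ring
  simp only [e]
  rw [integral_exp_mul_complex hc]
  have e2 : -((a : ℂ) * Complex.I) * (h : ℝ) = -(Real.pi * Complex.I) := by
    rw [hh]
    push_cast
    have : (a : ℂ) ≠ 0 := by exact_mod_cast ha0.ne'
    field_simp
  rw [e2, Complex.exp_neg, Complex.exp_pi_mul_I]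
  simp only [Complex.ofReal_zero, mul_zero, Complex.exp_zero]
  refine div_ne_zero ?_ hc
  norm_num

lemma IsExpTypeAtMost.comp_neg {σ : ℝ} {K : ℂ → ℂ} (hK : IsExpTypeAtMost σ K) :
    IsExpTypeAtMost σ fun z => K (-z) := by
  refine ⟨hK.entire.comp differentiable_neg, fun ε hε => ?_⟩
  obtain ⟨C, hC, hg⟩ := hK.growth ε hε
  exact ⟨C, hC, fun z => by simpa using hg (-z)⟩

lemma IsExpTypeAtMost.integral_mul_exp_eq_zero {σ : ℝ} (hσ : 0 < σ) {K : ℂ → ℂ}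
    (hK : IsExpTypeAtMost σ K) (hi : Integrable fun x : ℝ => K x) {a : ℝ} (ha : σ ≤ |a|) :
    ∫ x : ℝ, K x * Complex.exp (a * x * Complex.I) = 0 := by
  rcases le_abs.1 ha with h | h
  · exact hK.integral_mul_exp_eq_zero_of_le hσ hi h
  · have hi' := hi.comp_neg
    push_cast at hi'
    have := hK.comp_neg.integral_mul_exp_eq_zero_of_le hσ hi' h
    rw [← this, ← integral_neg_eq_self]
    push_cast
    simp

/-! ### The square wave `sgn (sin θ)` and orthogonality to functions of type `π`. -/

lemma hasSum_complex_log_sub_log {z : ℂ} (hz : ‖z‖ < 1) :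
    HasSum (fun k : ℕ => 2 * (z ^ (2 * k + 1) / (2 * k + 1)))
      (Complex.log (1 + z) - Complex.log (1 - z)) := by
  have h1 := Complex.hasSum_taylorSeries_neg_log hz
  have h2 := Complex.hasSum_taylorSeries_neg_log (z := -z) (by simpa using hz)
  have h := h1.sub h2
  rw [sub_neg_eq_add, sub_neg_eq_add] at h
  rw [show Complex.log (1 + z) - Complex.log (1 - z) =
    -Complex.log (1 - z) + Complex.log (1 + z) by ring]
  rw [← (show Function.Injective fun k : ℕ => 2 * k + 1 from
    fun a b h => by simpa using h).hasSum_iff] at h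
  · convert! h using 1
    ext k
    simp only [Function.comp_apply]
    rw [Odd.neg_pow ⟨k, rfl⟩]
    push_cast
    ring
  · intro n hn
    have he : Even n := by
      rw [← Nat.not_odd_iff_even]
      rintro ⟨k, rfl⟩
      exact hn ⟨k, rfl⟩
    rw [he.neg_pow, sub_self]

/-- The Abel means of the Fourier series of the sign of `sin θ`. -/
def squareWave (r θ : ℝ) : ℝ :=
  2 / Real.pi * (Complex.log (1 + r * Complex.exp (θ * Complex.I)) -
    Complex.log (1 - r * Complex.exp (θ * Complex.I))).im

lemma hasSum_squareWave {r : ℝ} (h0 : 0 ≤ r) (h1 : r < 1) (θ : ℝ) :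
    HasSum (fun k : ℕ => 4 / Real.pi * (r ^ (2 * k + 1) / (2 * k + 1)) *
      Real.sin ((2 * k + 1) * θ)) (squareWave r θ) := by
  have hz : ‖(r : ℂ) * Complex.exp (θ * Complex.I)‖ < 1 := by
    rw [norm_mul, Complex.norm_exp_ofReal_mul_I, Complex.norm_real, Real.norm_eq_abs,
      abs_of_nonneg h0, mul_one]
    exact h1
  convert! (Complex.hasSum_im (hasSum_complex_log_sub_log hz)).mul_left (2 / Real.pi) using 1
  ext k
  rw [mul_pow, ← Complex.exp_nat_mul, ← mul_assoc, ← Complex.ofReal_pow]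
  have e1 : ((2 * k + 1 : ℕ) : ℂ) * θ = (((2 * k + 1) * θ : ℝ) : ℂ) := by push_cast; ring
  have e2 : 2 * ((r ^ (2 * k + 1) : ℝ) * Complex.exp (((2 * k + 1) * θ : ℝ) * Complex.I) /
      (2 * k + 1)) = ((2 * (r ^ (2 * k + 1) / (2 * k + 1)) : ℝ) : ℂ) *
        Complex.exp (((2 * k + 1) * θ : ℝ) * Complex.I) := by push_cast; ring
  rw [e1, e2, Complex.im_ofReal_mul, Complex.exp_ofReal_mul_I_im]
  ring

lemma one_add_mul_exp_re_nonneg {r : ℝ} (hr : |r| ≤ 1) (θ : ℝ) :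
    0 ≤ (1 + r * Complex.exp (θ * Complex.I)).re := by
  rw [Complex.add_re, Complex.one_re, Complex.re_ofReal_mul, Complex.exp_ofReal_mul_I_re]
  have : |r * Real.cos θ| ≤ 1 := by
    rw [abs_mul]
    exact mul_le_one₀ hr (abs_nonneg _) (Real.abs_cos_le_one θ)
  linarith [neg_abs_le (r * Real.cos θ)]

/-- Both logarithms are taken at points of the closed right half-plane, so each argument is at most
`π/2` in modulus. -/
lemma abs_squareWave_le {r : ℝ} (h0 : 0 ≤ r) (h1 : r ≤ 1) (θ : ℝ) : |squareWave r θ| ≤ 2 := by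
  have a1 := Complex.abs_arg_le_pi_div_two_iff.2
    (one_add_mul_exp_re_nonneg (r := r) (by rwa [abs_of_nonneg h0]) θ)
  have a2 := Complex.abs_arg_le_pi_div_two_iff.2
    (one_add_mul_exp_re_nonneg (r := -r) (by rwa [abs_neg, abs_of_nonneg h0]) θ)
  rw [Complex.ofReal_neg, neg_mul, ← sub_eq_add_neg] at a2
  rw [squareWave, abs_mul, abs_of_pos (by positivity), Complex.sub_im, Complex.log_im,
    Complex.log_im]
  have := Real.pi_pos
  calc _ ≤ 2 / Real.pi * (Real.pi / 2 + Real.pi / 2) := by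
        gcongr
        exact (abs_sub _ _).trans (add_le_add a1 a2)
    _ = 2 := by field_simp; norm_num

/-- In polar form `1 + exp (iθ)` has argument `θ/2` and `1 - exp (iθ)` has argument `θ/2 - π/2`;
their difference is `π/2`. -/
lemma squareWave_one_of_mem_Ioo {θ : ℝ} (hθ : θ ∈ Set.Ioo 0 Real.pi) : squareWave 1 θ = 1 := by
  have hπ := Real.pi_pos
  have hs : 0 < Real.sin (θ / 2) := Real.sin_pos_of_pos_of_lt_pi (by linarith [hθ.1])
    (by linarith [hθ.2])
  have hc : 0 < Real.cos (θ / 2) := Real.cos_pos_of_mem_Ioo ⟨by linarith [hθ.1], by linarith [hθ.2]⟩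
  have e1 : (1 : ℂ) + (1 : ℝ) * Complex.exp (θ * Complex.I) =
      ((2 * Real.cos (θ / 2) : ℝ) : ℂ) * (Complex.cos ((θ / 2 : ℝ) : ℂ) +
        Complex.sin ((θ / 2 : ℝ) : ℂ) * Complex.I) := by
    rw [Complex.exp_mul_I, show (θ : ℂ) = 2 * ((θ / 2 : ℝ) : ℂ) by push_cast; ring,
      Complex.cos_two_mul, Complex.sin_two_mul]
    push_cast
    ring
  have e2 : (1 : ℂ) - (1 : ℝ) * Complex.exp (θ * Complex.I) =
      ((2 * Real.sin (θ / 2) : ℝ) : ℂ) * (Complex.cos ((θ / 2 - Real.pi / 2 : ℝ) : ℂ) +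
        Complex.sin ((θ / 2 - Real.pi / 2 : ℝ) : ℂ) * Complex.I) := by
    rw [Complex.exp_mul_I, show (θ : ℂ) = 2 * ((θ / 2 : ℝ) : ℂ) by push_cast; ring,
      Complex.cos_two_mul', Complex.sin_two_mul]
    push_cast
    rw [Complex.cos_sub_pi_div_two, Complex.sin_sub_pi_div_two]
    linear_combination (-1 : ℂ) * Complex.sin_sq_add_cos_sq ((θ : ℂ) / 2)
  rw [squareWave, Complex.sub_im, Complex.log_im, Complex.log_im, e1, e2,
    Complex.arg_mul_cos_add_sin_mul_I (by positivity) ⟨by linarith [hθ.1], by linarith [hθ.2]⟩,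
    Complex.arg_mul_cos_add_sin_mul_I (by positivity) ⟨by linarith [hθ.1], by linarith [hθ.2]⟩]
  field_simp
  ring

lemma squareWave_neg {r : ℝ} (h0 : 0 ≤ r) (h1 : r < 1) (θ : ℝ) :
    squareWave r (-θ) = -squareWave r θ := by
  rw [← (hasSum_squareWave h0 h1 (-θ)).tsum_eq, ← (hasSum_squareWave h0 h1 θ).neg.tsum_eq]
  refine tsum_congr fun k => ?_
  rw [mul_neg, Real.sin_neg, mul_neg]

lemma squareWave_add_two_pi (r θ : ℝ) : squareWave r (θ + 2 * Real.pi) = squareWave r θ := by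
  have : Complex.exp (((θ + 2 * Real.pi : ℝ) : ℂ) * Complex.I) = Complex.exp (θ * Complex.I) := by
    rw [← Complex.exp_periodic (θ * Complex.I)]
    push_cast
    ring_nf
  rw [squareWave, squareWave, this]

lemma tendsto_squareWave_of_mem_Ioo {θ : ℝ} (hθ : θ ∈ Set.Ioo 0 Real.pi) :
    Tendsto (fun r => squareWave r θ) (𝓝[<] 1) (𝓝 1) := by
  have him : Complex.exp (θ * Complex.I) ∉ Set.range ((↑) : ℝ → ℂ) := by
    rintro ⟨y, hy⟩
    have := congrArg Complex.im hy
    rw [Complex.ofReal_im, Complex.exp_ofReal_mul_I_im] at this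
    exact (Real.sin_pos_of_mem_Ioo hθ).ne this
  have hsin := (Real.sin_pos_of_mem_Ioo hθ).ne'
  have hc : ContinuousAt (fun r : ℝ => squareWave r θ) 1 := by
    unfold squareWave
    refine continuousAt_const.mul (Complex.continuous_im.continuousAt.comp
      (ContinuousAt.sub (ContinuousAt.clog (by fun_prop) ?_)
        (ContinuousAt.clog (by fun_prop) ?_)))
    · refine Or.inr ?_
      simpa [Complex.exp_ofReal_mul_I_im] using hsin
    · refine Or.inr ?_
      simpa [Complex.exp_ofReal_mul_I_im] using hsin
  have := hc.tendsto
  rw [squareWave_one_of_mem_Ioo hθ] at this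
  exact this.mono_left nhdsWithin_le_nhds

lemma tendsto_squareWave {θ : ℝ} (hθ : Real.sin θ ≠ 0) :
    Tendsto (fun r => squareWave r θ) (𝓝[<] 1) (𝓝 (Real.sign (Real.sin θ))) := by
  obtain ⟨φ, hφ, m, hm⟩ : ∃ φ ∈ Set.Ioc (-Real.pi) Real.pi, ∃ m : ℤ, θ = φ + m * (2 * Real.pi) := by
    obtain ⟨φ, hφ, h⟩ := existsUnique_sub_zsmul_mem_Ioc Real.two_pi_pos θ (-Real.pi) |>.exists.elim
      fun m hm => (⟨_, hm, m, rfl⟩ : ∃ φ ∈ Set.Ioc (-Real.pi) (-Real.pi + 2 * Real.pi), ∃ m : ℤ,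
        φ = θ - m • (2 * Real.pi))
    obtain ⟨m, rfl⟩ := h
    refine ⟨_, ⟨hφ.1, by linarith [hφ.2]⟩, m, ?_⟩
    simp
  have hper : ∀ r, squareWave r θ = squareWave r φ := by
    intro r
    rw [hm]
    have : Function.Periodic (squareWave r) (2 * Real.pi) := squareWave_add_two_pi r
    exact this.int_mul m φ
  have hsin : Real.sin θ = Real.sin φ := by
    rw [hm, Real.sin_add_int_mul_two_pi]
  rw [hsin] at hθ ⊢
  simp only [hper]
  have hφ0 : φ ≠ 0 := by rintro rfl; simp at hθ
  have hφπ : φ ≠ Real.pi := by rintro rfl; simp at hθ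
  rcases lt_or_gt_of_ne hφ0 with h | h
  · have hmem : -φ ∈ Set.Ioo 0 Real.pi := ⟨by linarith, by linarith [hφ.1]⟩
    have h1 := Real.sin_pos_of_mem_Ioo hmem
    rw [Real.sin_neg] at h1
    rw [Real.sign_of_neg (by linarith)]
    refine (tendsto_squareWave_of_mem_Ioo hmem).neg.congr' ?_
    filter_upwards [Ioo_mem_nhdsLT (zero_lt_one' ℝ)] with r hr
    rw [squareWave_neg hr.1.le hr.2, neg_neg]
  · have hmem : φ ∈ Set.Ioo 0 Real.pi := ⟨h, lt_of_le_of_ne hφ.2 hφπ⟩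
    rw [Real.sign_of_pos (Real.sin_pos_of_mem_Ioo hmem)]
    exact tendsto_squareWave_of_mem_Ioo hmem

lemma ae_sin_pi_mul_ne_zero : ∀ᵐ x : ℝ, Real.sin (Real.pi * x) ≠ 0 := by
  have hc : (Set.range ((↑) : ℤ → ℝ)).Countable := Set.countable_range _
  filter_upwards [hc.ae_notMem volume] with x hx
  exact sin_pi_mul_ne_zero_of_forall fun n hn => hx ⟨n, hn.symm⟩

/-- Integration against the sign of `sin (π x)`, as an Abel limit of sine transforms. -/
lemma tendsto_tsum_sine_transform {E : Type*} [NormedAddCommGroup E] [NormedSpace ℝ E]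
    {f : ℝ → E} (hf : Integrable f) :
    Tendsto (fun r : ℝ => ∑' k : ℕ, (4 / Real.pi * (r ^ (2 * k + 1) / (2 * k + 1))) •
        ∫ x, Real.sin ((2 * k + 1) * (Real.pi * x)) • f x)
      (𝓝[<] 1) (𝓝 (∫ x, Real.sign (Real.sin (Real.pi * x)) • f x)) := by
  have hsinf : ∀ k : ℕ, Integrable fun x => Real.sin ((2 * k + 1) * (Real.pi * x)) • f x := by
    intro k
    refine hf.bdd_smul 1 (Continuous.aestronglyMeasurable (by fun_prop)) ?_
    exact Eventually.of_forall fun x => Real.abs_sin_le_one _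
  have hcoef : ∀ r ∈ Set.Ioo (0 : ℝ) 1,
      Summable fun k : ℕ => 4 / Real.pi * (r ^ (2 * k + 1) / (2 * k + 1)) := by
    intro r hr
    have hg : Summable fun k : ℕ => r ^ (2 * k + 1) :=
      (summable_geometric_of_lt_one hr.1.le hr.2).comp_injective
        (i := fun k : ℕ => 2 * k + 1) fun a b h => by simpa using h
    refine (hg.of_nonneg_of_le (fun k => ?_) fun k => ?_).mul_left _
    · have := hr.1.le
      positivity
    · exact div_le_self (pow_nonneg hr.1.le _) (by linarith [(Nat.cast_nonneg k : (0 : ℝ) ≤ k)])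
  -- For `r < 1` the sine coefficients are absolutely summable, so sum and integral may be
  -- exchanged; at `r = 1` they are not, whence the Abel limit.
  have hint : ∀ r ∈ Set.Ioo (0 : ℝ) 1, ∑' k : ℕ, (4 / Real.pi * (r ^ (2 * k + 1) / (2 * k + 1))) •
      (∫ x, Real.sin ((2 * k + 1) * (Real.pi * x)) • f x) =
      ∫ x, squareWave r (Real.pi * x) • f x := by
    intro r hr
    have h := integral_tsum_of_summable_integral_norm (μ := volume)
      (F := fun (k : ℕ) x => (4 / Real.pi * (r ^ (2 * k + 1) / (2 * k + 1))) •
        (Real.sin ((2 * k + 1) * (Real.pi * x)) • f x)) (fun k => (hsinf k).smul _) ?_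
    · simp only [integral_smul] at h
      rw [h]
      refine integral_congr_ae (Eventually.of_forall fun x => ?_)
      have h2 := hasSum_squareWave hr.1.le hr.2 (Real.pi * x)
      simp only
      rw [← h2.tsum_eq, ← h2.summable.tsum_smul_const]
      exact tsum_congr fun k => smul_smul _ _ _
    · refine ((hcoef r hr).mul_right (∫ x, ‖f x‖)).of_nonneg_of_le
        (fun k => integral_nonneg fun _ => norm_nonneg _) fun k => ?_
      have hc : 0 ≤ 4 / Real.pi * (r ^ (2 * k + 1) / (2 * k + 1)) := by
        have := hr.1.le
        positivity
      rw [← integral_const_mul]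
      refine integral_mono ((hsinf k).smul _).norm (hf.norm.const_mul _) fun x => ?_
      rw [norm_smul, norm_smul, Real.norm_of_nonneg hc]
      exact mul_le_mul_of_nonneg_left
        (mul_le_of_le_one_left (norm_nonneg _) (Real.abs_sin_le_one _)) hc
  have hlim : Tendsto (fun r : ℝ => ∫ x, squareWave r (Real.pi * x) • f x) (𝓝[<] 1)
      (𝓝 (∫ x, Real.sign (Real.sin (Real.pi * x)) • f x)) := by
    refine tendsto_integral_filter_of_dominated_convergence (fun x => 2 * ‖f x‖) ?_ ?_
      (hf.norm.const_mul 2) ?_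
    · refine Eventually.of_forall fun r => AEStronglyMeasurable.smul ?_ hf.aestronglyMeasurable
      refine Measurable.aestronglyMeasurable ?_
      unfold squareWave
      fun_prop
    · filter_upwards [Ioo_mem_nhdsLT (zero_lt_one' ℝ)] with r hr
      refine Eventually.of_forall fun x => ?_
      rw [norm_smul]
      exact mul_le_mul_of_nonneg_right (abs_squareWave_le hr.1.le hr.2.le _) (norm_nonneg _)
    · filter_upwards [ae_sin_pi_mul_ne_zero] with x hx
      exact (tendsto_squareWave hx).smul_const _
  refine hlim.congr' ?_
  filter_upwards [Ioo_mem_nhdsLT (zero_lt_one' ℝ)] with r hr using (hint r hr).symm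

/-- Integrable functions of exponential type `π` are orthogonal to the sign of `sin (π x)`. -/
lemma IsExpTypeAtMost.integral_sign_sin_smul_eq_zero {K : ℂ → ℂ}
    (hK : IsExpTypeAtMost Real.pi K) (hi : Integrable fun x : ℝ => K x) :
    ∫ x : ℝ, Real.sign (Real.sin (Real.pi * x)) • K x = 0 := by
  have h0 : ∀ k : ℕ, ∫ x : ℝ, Real.sin ((2 * k + 1) * (Real.pi * x)) • K x = 0 := by
    intro k
    set a : ℝ := (2 * k + 1) * Real.pi with ha
    have hπ := Real.pi_pos
    have ha' : Real.pi ≤ a := by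
      have : (0 : ℝ) ≤ k := Nat.cast_nonneg k
      nlinarith
    have ha0 : |a| = a := abs_of_pos (hπ.trans_le ha')
    have hint : ∀ b : ℝ, Integrable fun x : ℝ => K x * Complex.exp (b * x * Complex.I) := by
      intro b
      refine hi.mul_bdd (c := 1) (Continuous.aestronglyMeasurable (by fun_prop)) ?_
      refine Eventually.of_forall fun x => ?_
      rw [← Complex.ofReal_mul, Complex.norm_exp_ofReal_mul_I]
    have h1 := hK.integral_mul_exp_eq_zero hπ hi (a := a) (by rwa [ha0])
    have h2 := hK.integral_mul_exp_eq_zero hπ hi (a := -a) (by rwa [abs_neg, ha0])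
    have e : ∀ x : ℝ, Real.sin ((2 * k + 1) * (Real.pi * x)) • K x =
        (Complex.I / 2) * (K x * Complex.exp ((-a : ℝ) * x * Complex.I) -
          K x * Complex.exp (a * x * Complex.I)) := by
      intro x
      rw [Complex.real_smul, Complex.ofReal_sin, Complex.sin]
      rw [show (((2 * k + 1) * (Real.pi * x) : ℝ) : ℂ) = a * x by rw [ha]; push_cast; ring]
      push_cast
      rw [neg_mul]
      ring_nf
    simp only [e]
    rw [integral_const_mul, integral_sub (hint _) (hint _), h1, h2]
    simp
  have h := tendsto_tsum_sine_transform hi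
  simp only [h0, smul_zero, tsum_zero] at h
  exact tendsto_nhds_unique h tendsto_const_nhds

/-! ### The sine transform of the half-line Gaussian and the theta integral. -/

lemma hasDerivAt_gaussian (b x : ℝ) :
    HasDerivAt (fun x => Real.exp (-b * x ^ 2)) (-(2 * b * x) * Real.exp (-b * x ^ 2)) x := by
  have h : HasDerivAt (fun x : ℝ => -b * x ^ 2) (-b * (2 * x)) x := by
    simpa using (hasDerivAt_pow 2 x).const_mul (-b)
  convert! h.exp using 1
  ring

/-- The sine transform of a Gaussian on the half-line. -/
def gaussianSineTransform (b ω : ℝ) : ℝ :=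
  ∫ x in Set.Ioi (0 : ℝ), Real.exp (-b * x ^ 2) * Real.sin (ω * x)

lemma integrable_gaussian_mul_sin {b : ℝ} (hb : 0 < b) (ω : ℝ) :
    Integrable fun x : ℝ => Real.exp (-b * x ^ 2) * Real.sin (ω * x) :=
  (integrable_exp_neg_mul_sq hb).mul_bdd (c := 1)
    (Continuous.aestronglyMeasurable (by fun_prop))
    (Eventually.of_forall fun x => Real.abs_sin_le_one _)

/-- Differentiation under the integral gives the transform of `x exp (-bx²)` against the cosine;
integration by parts returns to the sine transform, with `1/(2b)` as the boundary term at `0`. -/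
lemma hasDerivAt_gaussianSineTransform {b : ℝ} (hb : 0 < b) (ω : ℝ) :
    HasDerivAt (gaussianSineTransform b)
      (1 / (2 * b) - ω / (2 * b) * gaussianSineTransform b ω) ω := by
  have hxg := integrable_mul_exp_neg_mul_sq hb
  have hxg' : Integrable fun x : ℝ => x * Real.exp (-b * x ^ 2) * Real.cos (ω * x) :=
    hxg.mul_bdd (c := 1) (Continuous.aestronglyMeasurable (by fun_prop))
      (Eventually.of_forall fun x => Real.abs_cos_le_one _)
  have h := (hasDerivAt_integral_of_dominated_loc_of_deriv_le (𝕜 := ℝ)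
    (μ := volume.restrict (Set.Ioi (0 : ℝ)))
    (F := fun ω x => Real.exp (-b * x ^ 2) * Real.sin (ω * x))
    (F' := fun ω x => x * Real.exp (-b * x ^ 2) * Real.cos (ω * x))
    (bound := fun x => ‖x * Real.exp (-b * x ^ 2)‖) (x₀ := ω) (s := Set.univ) univ_mem
    (Eventually.of_forall fun ω => (integrable_gaussian_mul_sin hb ω).integrableOn.1)
    (integrable_gaussian_mul_sin hb ω).integrableOn hxg'.integrableOn.1
    (Eventually.of_forall fun x ω _ => ?_) hxg.norm.integrableOn
    (Eventually.of_forall fun x ω _ => ?_)).2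
  · convert! h using 1
    have hparts : ∫ x in Set.Ioi (0 : ℝ), (x * Real.exp (-b * x ^ 2) * Real.cos (ω * x) +
        ω / (2 * b) * (Real.exp (-b * x ^ 2) * Real.sin (ω * x))) =
        0 - -(1 / (2 * b)) * (Real.exp (-b * 0 ^ 2) * Real.cos (ω * 0)) := by
      refine integral_Ioi_of_hasDerivAt_of_tendsto'
        (f := fun x => -(1 / (2 * b)) * (Real.exp (-b * x ^ 2) * Real.cos (ω * x)))
        (fun x _ => ?_)
        (hxg'.integrableOn.add ((integrable_gaussian_mul_sin hb ω).integrableOn.const_mul _)) ?_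
      · have h1 := hasDerivAt_gaussian b x
        have h2 : HasDerivAt (fun x => Real.cos (ω * x)) (-Real.sin (ω * x) * ω) x := by
          have := ((hasDerivAt_id x).const_mul ω).cos
          simpa using this
        convert! (h1.mul h2).const_mul (-(1 / (2 * b))) using 1
        field_simp
        ring
      · have h0 : Tendsto (fun x : ℝ => Real.exp (-b * x ^ 2)) atTop (𝓝 0) := by
          refine Real.tendsto_exp_atBot.comp ?_
          exact (tendsto_pow_atTop two_ne_zero).const_mul_atTop_of_neg (neg_lt_zero.2 hb)
        have h1 : Tendsto (fun x : ℝ => Real.exp (-b * x ^ 2) * Real.cos (ω * x)) atTop (𝓝 0) := by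
          refine squeeze_zero_norm (fun x => ?_) h0
          rw [norm_mul, Real.norm_eq_abs, Real.abs_exp]
          exact mul_le_of_le_one_right (Real.exp_pos _).le (Real.abs_cos_le_one _)
        have h2 := h1.const_mul (-(1 / (2 * b)))
        rwa [mul_zero] at h2
    rw [integral_add hxg'.integrableOn
      ((integrable_gaussian_mul_sin hb ω).integrableOn.const_mul _), integral_const_mul] at hparts
    simp at hparts
    rw [gaussianSineTransform, one_div, mul_inv]
    have e : ∀ x : ℝ, -(b * x ^ 2) = -b * x ^ 2 := fun x => by ring
    simp only [e] at hparts
    linarith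
  · rw [norm_mul]
    exact mul_le_of_le_one_right (norm_nonneg _) (Real.abs_cos_le_one _)
  · have h1 : HasDerivAt (fun ω => Real.sin (ω * x)) (Real.cos (ω * x) * x) ω := by
      have := ((hasDerivAt_id ω).mul_const x).sin
      simpa using this
    convert! h1.const_mul (Real.exp (-b * x ^ 2)) using 1
    ring

lemma gaussianSineTransform_eq {b : ℝ} (hb : 0 < b) (ω : ℝ) :
    gaussianSineTransform b ω =
      ω / (2 * b) * ∫ y in (0 : ℝ)..1, Real.exp (-(ω ^ 2 / (4 * b)) * (1 - y ^ 2)) := by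
  -- The integrating factor of the linear equation is `exp (ω²/(4b))`. The doubled sign lets
  -- `hasDerivAt_gaussian` apply with parameter `-1/(4b)`.
  have hd : ∀ w, HasDerivAt
      (fun w => Real.exp (-(-(1 / (4 * b))) * w ^ 2) * gaussianSineTransform b w)
      (Real.exp (-(-(1 / (4 * b))) * w ^ 2) / (2 * b)) w := by
    intro w
    convert! (hasDerivAt_gaussian (-(1 / (4 * b))) w).mul
      (hasDerivAt_gaussianSineTransform hb w) using 1
    field_simp
    ring
  have hftc := intervalIntegral.integral_eq_sub_of_hasDerivAt (a := 0) (b := ω)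
    (fun w _ => hd w) (Continuous.intervalIntegrable (by fun_prop) _ _)
  have h0 : gaussianSineTransform b 0 = 0 := by simp [gaussianSineTransform]
  rw [h0, mul_zero, sub_zero] at hftc
  have hsub := intervalIntegral.mul_integral_comp_mul_left (a := 0) (b := 1) (c := ω)
    (f := fun w => Real.exp (-(-(1 / (4 * b))) * w ^ 2) / (2 * b))
  rw [mul_zero, mul_one, hftc] at hsub
  have he : Real.exp (-(ω ^ 2 / (4 * b))) * Real.exp (-(-(1 / (4 * b))) * ω ^ 2) = 1 := by
    rw [← Real.exp_add, show -(ω ^ 2 / (4 * b)) + -(-(1 / (4 * b))) * ω ^ 2 = 0 by ring,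
      Real.exp_zero]
  calc gaussianSineTransform b ω = Real.exp (-(ω ^ 2 / (4 * b))) *
        (Real.exp (-(-(1 / (4 * b))) * ω ^ 2) * gaussianSineTransform b ω) := by
        rw [← mul_assoc, he, one_mul]
    _ = _ := by
        rw [← hsub, ← intervalIntegral.integral_const_mul, ← intervalIntegral.integral_const_mul,
          ← intervalIntegral.integral_const_mul]
        refine intervalIntegral.integral_congr fun y _ => ?_
        rw [show -(ω ^ 2 / (4 * b)) * (1 - y ^ 2) =
          -(ω ^ 2 / (4 * b)) + -(-(1 / (4 * b))) * (ω * y) ^ 2 by ring, Real.exp_add]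
        ring

/-- The integral over `(0, 1)` of one term of the theta series. -/
def thetaTermIntegral (c : ℝ) : ℝ := ∫ y in (0 : ℝ)..1, Real.exp (-c * (1 - y ^ 2))

lemma thetaTermIntegral_nonneg (c : ℝ) : 0 ≤ thetaTermIntegral c :=
  intervalIntegral.integral_nonneg zero_le_one fun _ _ => (Real.exp_pos _).le

/-- On `[0, 1]` one has `1 - y² ≥ 1 - y`, which leaves an elementary exponential integral. -/
lemma thetaTermIntegral_le {c : ℝ} (hc : 0 < c) : thetaTermIntegral c ≤ 1 / c := by
  have h1 : thetaTermIntegral c ≤ ∫ y in (0 : ℝ)..1, Real.exp (c * y - c) := by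
    refine intervalIntegral.integral_mono_on zero_le_one
      (Continuous.intervalIntegrable (by fun_prop) _ _)
      (Continuous.intervalIntegrable (by fun_prop) _ _) fun y hy => Real.exp_le_exp.2 ?_
    have : 0 ≤ c * (y * (1 - y)) :=
      mul_nonneg hc.le (mul_nonneg hy.1 (sub_nonneg.2 hy.2))
    linarith
  have h2 : ∫ y in (0 : ℝ)..1, Real.exp (c * y - c) = Real.exp (c * 1 - c) / c -
      Real.exp (c * 0 - c) / c := by
    refine intervalIntegral.integral_eq_sub_of_hasDerivAt (f := fun y => Real.exp (c * y - c) / c)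
      (fun y _ => ?_) (Continuous.intervalIntegrable (by fun_prop) _ _)
    have := ((((hasDerivAt_id y).const_mul c).sub_const c).exp).div_const c
    convert! this using 1
    simp only [id]
    field_simp
  rw [h2] at h1
  refine h1.trans ?_
  rw [mul_one, sub_self, Real.exp_zero]
  have := Real.exp_pos (c * 0 - c)
  have : 0 ≤ Real.exp (c * 0 - c) / c := by positivity
  linarith

lemma summable_thetaTermIntegral {lam : ℝ} (hlam : 0 < lam) :
    Summable fun n : ℤ => thetaTermIntegral (Real.pi * lam⁻¹ * (n + 1 / 2) ^ 2) := by
  have h := (Real.summable_one_div_int_add_rpow (1 / 2) 2).2 one_lt_two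
  refine (h.mul_left (1 / (Real.pi * lam⁻¹))).of_nonneg_of_le
    (fun n => thetaTermIntegral_nonneg _) fun n => ?_
  have hne : (n : ℝ) + 1 / 2 ≠ 0 := by
    intro h
    have h2 : ((2 * n + 1 : ℤ) : ℝ) = 0 := by push_cast; linarith
    have h3 : 2 * n + 1 = 0 := by exact_mod_cast h2
    omega
  refine (thetaTermIntegral_le (by positivity)).trans_eq ?_
  rw [Real.rpow_two, sq_abs, one_div_mul_one_div]

lemma integrable_tsum_of_nonneg {α ι : Type*} [MeasurableSpace α] [Countable ι] {μ : Measure α}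
    {f : ι → α → ℝ} (hm : ∀ i, Measurable (f i)) (h0 : ∀ i a, 0 ≤ f i a)
    (hi : ∀ i, Integrable (f i) μ) (hs : Summable fun i => ∫ a, f i a ∂μ) :
    Integrable (fun a => ∑' i, f i a) μ := by
  have hmeas : ∀ i, Measurable fun a => ENNReal.ofReal (f i a) := fun i => (hm i).ennreal_ofReal
  have h := integrable_toReal_of_lintegral_ne_top (μ := μ)
    (f := fun a => ∑' i, ENNReal.ofReal (f i a)) (Measurable.tsum hmeas).aemeasurable ?_
  · refine h.congr (Eventually.of_forall fun a => ?_)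
    simp only
    rw [ENNReal.tsum_toReal_eq fun i => ENNReal.ofReal_ne_top]
    exact tsum_congr fun i => ENNReal.toReal_ofReal (h0 i a)
  · rw [lintegral_tsum fun i => (hmeas i).aemeasurable]
    simp_rw [← ofReal_integral_eq_lintegral_ofReal (hi _) (Eventually.of_forall (h0 _))]
    rw [← ENNReal.ofReal_tsum_of_nonneg (fun i => integral_nonneg (h0 i)) hs]
    exact ENNReal.ofReal_ne_top

/-- The identity is termwise and needs no convergence: where the series diverges, as at `y = 1`,
both sides are `0`. -/
lemma thetaOne_thetaPoint (lam y : ℝ) : thetaOne 0 (thetaPoint lam y) =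
    ((∑' n : ℤ, Real.exp (-(Real.pi * lam⁻¹ * (n + 1 / 2) ^ 2) * (1 - y ^ 2)) : ℝ) : ℂ) := by
  rw [thetaOne, Complex.ofReal_tsum]
  refine tsum_congr fun n => ?_
  rw [mul_zero, Complex.exp_zero, mul_one, thetaPoint]
  push_cast
  congr 1
  linear_combination (Real.pi * (lam : ℂ)⁻¹ * (1 - (y : ℂ) ^ 2) * (n + 1 / 2) ^ 2) * Complex.I_mul_I

lemma integrableOn_thetaTerm (c : ℝ) :
    Integrable (fun y : ℝ => Real.exp (-c * (1 - y ^ 2))) (volume.restrict (Set.Ioc 0 1)) := by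
  have : IntervalIntegrable (fun y : ℝ => Real.exp (-c * (1 - y ^ 2))) volume 0 1 :=
    Continuous.intervalIntegrable (by fun_prop) _ _
  exact (intervalIntegrable_iff_integrableOn_Ioc_of_le zero_le_one).1 this

lemma integral_thetaTerm (c : ℝ) :
    ∫ y in Set.Ioc (0 : ℝ) 1, Real.exp (-c * (1 - y ^ 2)) = thetaTermIntegral c := by
  rw [thetaTermIntegral, intervalIntegral.integral_of_le zero_le_one]

lemma intervalIntegrable_thetaOne {lam : ℝ} (hlam : 0 < lam) :
    IntervalIntegrable (fun y : ℝ => thetaOne 0 (thetaPoint lam y)) volume 0 1 := by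
  rw [intervalIntegrable_iff_integrableOn_Ioc_of_le zero_le_one]
  simp only [thetaOne_thetaPoint]
  refine Integrable.ofReal ?_
  refine integrable_tsum_of_nonneg (fun n => by fun_prop) (fun n y => (Real.exp_pos _).le)
    (fun n => integrableOn_thetaTerm _) ?_
  simpa only [integral_thetaTerm] using summable_thetaTermIntegral hlam

/-- The reflection `n ↦ -(n+1)` preserves `(n + 1/2)²`, so the sum over the integers is twice the
sum over the naturals. -/
lemma minimalValue_eq_tsum {lam : ℝ} (hlam : 0 < lam) :
    minimalValue lam = 2 / (Real.pi * lam) *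
      ∑' k : ℕ, thetaTermIntegral (Real.pi * lam⁻¹ * (k + 1 / 2) ^ 2) := by
  have hs := summable_thetaTermIntegral hlam
  have h1 : ∫ y in (0 : ℝ)..1, (thetaOne 0 (thetaPoint lam y)).re =
      ∑' n : ℤ, thetaTermIntegral (Real.pi * lam⁻¹ * (n + 1 / 2) ^ 2) := by
    simp only [thetaOne_thetaPoint, Complex.ofReal_re]
    rw [intervalIntegral.integral_of_le zero_le_one, ← integral_tsum_of_summable_integral_norm
      (fun n : ℤ => integrableOn_thetaTerm (Real.pi * lam⁻¹ * (n + 1 / 2) ^ 2))]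
    · exact tsum_congr fun n => integral_thetaTerm _
    · simpa only [Real.norm_eq_abs, Real.abs_exp, integral_thetaTerm] using hs
  have h2 := tsum_of_nat_of_neg_add_one
    (f := fun n : ℤ => thetaTermIntegral (Real.pi * lam⁻¹ * (n + 1 / 2) ^ 2))
    (hs.comp_injective Nat.cast_injective)
    (hs.comp_injective (i := fun n : ℕ => -((n : ℤ) + 1)) fun a b h => by simpa using h)
  have h3 : ∀ k : ℕ, thetaTermIntegral (Real.pi * lam⁻¹ * (((-((k : ℤ) + 1) : ℤ) : ℝ) + 1 / 2) ^ 2)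
      = thetaTermIntegral (Real.pi * lam⁻¹ * (k + 1 / 2) ^ 2) := by
    intro k
    push_cast
    ring_nf
  simp only [h3, Int.cast_natCast] at h2
  rw [minimalValue, h1, h2]
  ring

lemma truncGaussian_of_pos (lam : ℝ) {x : ℝ} (hx : 0 < x) :
    truncGaussian lam x = Real.exp (-Real.pi * lam * x ^ 2) := by
  rw [truncGaussian, truncZero, Real.sign_of_pos hx]
  norm_num

lemma truncGaussian_of_neg (lam : ℝ) {x : ℝ} (hx : x < 0) : truncGaussian lam x = 0 := by
  rw [truncGaussian, truncZero, Real.sign_of_neg hx]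
  norm_num

lemma truncGaussian_ae_eq (lam : ℝ) : truncGaussian lam =ᵐ[volume]
    (Set.Ioi (0 : ℝ)).indicator fun x => Real.exp (-(Real.pi * lam) * x ^ 2) := by
  filter_upwards [compl_mem_ae_iff.2 (measure_singleton (0 : ℝ))] with x hx
  rcases lt_or_gt_of_ne (show x ≠ 0 from hx) with h | h
  · rw [truncGaussian_of_neg lam h, Set.indicator_of_notMem (by simpa using h.le)]
  · rw [truncGaussian_of_pos lam h, Set.indicator_of_mem (by simpa using h)]
    ring_nf

lemma integrable_truncGaussian {lam : ℝ} (hlam : 0 < lam) : Integrable (truncGaussian lam) :=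
  (((integrable_exp_neg_mul_sq (mul_pos Real.pi_pos hlam)).indicator measurableSet_Ioi)).congr
    (truncGaussian_ae_eq lam).symm

lemma integral_sin_mul_truncGaussian (lam ω : ℝ) :
    ∫ x, Real.sin (ω * x) * truncGaussian lam x = gaussianSineTransform (Real.pi * lam) ω := by
  rw [gaussianSineTransform, ← integral_indicator measurableSet_Ioi]
  refine integral_congr_ae ?_
  filter_upwards [truncGaussian_ae_eq lam] with x hx
  rw [hx]
  by_cases h : x ∈ Set.Ioi (0 : ℝ)
  · rw [Set.indicator_of_mem h, Set.indicator_of_mem h, mul_comm]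
  · rw [Set.indicator_of_notMem h, Set.indicator_of_notMem h, mul_zero]

/-- The minimal value is the integral of the truncated Gaussian against the sign of `sin (π x)`. -/
lemma integral_sign_sin_mul_truncGaussian {lam : ℝ} (hlam : 0 < lam) :
    ∫ x, Real.sign (Real.sin (Real.pi * x)) * truncGaussian lam x = minimalValue lam := by
  have h := tendsto_tsum_sine_transform (integrable_truncGaussian hlam)
  have hs : Summable fun k : ℕ => thetaTermIntegral (Real.pi * lam⁻¹ * (k + 1 / 2) ^ 2) := by
    simpa using! (summable_thetaTermIntegral hlam).comp_injective Nat.cast_injective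
  have hterm : ∀ (r : ℝ) (k : ℕ), (4 / Real.pi * (r ^ (2 * k + 1) / (2 * k + 1))) •
      (∫ x, Real.sin ((2 * k + 1) * (Real.pi * x)) • truncGaussian lam x) =
      2 / (Real.pi * lam) *
        (r ^ (2 * k + 1) * thetaTermIntegral (Real.pi * lam⁻¹ * (k + 1 / 2) ^ 2)) := by
    intro r k
    have hπ := Real.pi_pos
    have e1 : ∫ x, Real.sin ((2 * k + 1) * (Real.pi * x)) • truncGaussian lam x =
        gaussianSineTransform (Real.pi * lam) ((2 * k + 1) * Real.pi) := by
      rw [← integral_sin_mul_truncGaussian]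
      simp only [smul_eq_mul, mul_assoc]
    -- At the frequency `(2k+1)π` the Gaussian exponent becomes that of the theta series, and the
    -- prefactor of the transform cancels the `1/(2k+1)` of the square wave.
    have e2 : ((2 * k + 1) * Real.pi) ^ 2 / (4 * (Real.pi * lam)) =
        Real.pi * lam⁻¹ * ((k : ℝ) + 1 / 2) ^ 2 := by
      field_simp
      ring
    rw [e1, gaussianSineTransform_eq (by positivity), e2, ← thetaTermIntegral, smul_eq_mul]
    field_simp
    ring
  simp only [hterm, tsum_mul_left] at h
  have hlim : Tendsto (fun r : ℝ => 2 / (Real.pi * lam) * ∑' k : ℕ,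
      r ^ (2 * k + 1) * thetaTermIntegral (Real.pi * lam⁻¹ * (k + 1 / 2) ^ 2)) (𝓝[<] 1)
      (𝓝 (minimalValue lam)) := by
    rw [minimalValue_eq_tsum hlam]
    refine Tendsto.const_mul _ (tendsto_tsum_of_dominated_convergence hs (fun k => ?_) ?_)
    · have : Continuous fun r : ℝ =>
        r ^ (2 * k + 1) * thetaTermIntegral (Real.pi * lam⁻¹ * (k + 1 / 2) ^ 2) := by fun_prop
      simpa using (this.tendsto 1).mono_left nhdsWithin_le_nhds
    · filter_upwards [Ioo_mem_nhdsLT (zero_lt_one' ℝ)] with r hr k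
      rw [norm_mul, norm_pow, Real.norm_of_nonneg hr.1.le,
        Real.norm_of_nonneg (thetaTermIntegral_nonneg _)]
      exact mul_le_of_le_one_left (thetaTermIntegral_nonneg _) (pow_le_one₀ hr.1.le hr.2.le)
  exact tendsto_nhds_unique h hlim

/-! ### Uniqueness of interpolation at the nonzero integers. -/

/-- A continuous function on `[-1/2, 1/2]` that vanishes at the end points and whose nonzero
Fourier coefficients vanish is zero. -/
lemma eq_zero_of_fourier_coeff_eq_zero {g : ℝ → ℂ} (hg : Continuous g) (h0 : g (-(1 / 2)) = 0)
    (h1 : g (1 / 2) = 0)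
    (hc : ∀ n : ℤ, n ≠ 0 →
      ∫ x in (-(1 / 2) : ℝ)..(1 / 2), Complex.exp ((2 * Real.pi * n * x : ℝ) * Complex.I) * g x = 0)
    {x : ℝ} (hx : x ∈ Set.Ico (-(1 / 2)) (1 / 2)) : g x = 0 := by
  have : Fact ((0 : ℝ) < 1) := ⟨one_pos⟩
  have hcont : Continuous (AddCircle.liftIco (1 : ℝ) (-(1 / 2)) g) := by
    refine AddCircle.liftIco_continuous ?_ hg.continuousOn
    rw [h0, show -(1 / 2) + 1 = (1 / 2 : ℝ) by norm_num, h1]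
  set G : C(AddCircle (1 : ℝ), ℂ) := ⟨_, hcont⟩ with hG
  have hcoef : ∀ n : ℤ, n ≠ 0 → fourierCoeff G n = 0 := by
    intro n hn
    have e : fourierCoeff G n = fourierCoeff (AddCircle.liftIco (1 : ℝ) (-(1 / 2)) g) n := rfl
    rw [e, fourierCoeff_liftIco_eq, fourierCoeffOn_eq_integral]
    have := hc (-n) (neg_ne_zero.2 hn)
    rw [show (-(1 / 2) + 1 : ℝ) = 1 / 2 by norm_num]
    refine smul_eq_zero_of_right _ ?_
    rw [← this]
    refine intervalIntegral.integral_congr fun y _ => ?_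
    rw [fourier_coe_apply, smul_eq_mul]
    congr 2
    push_cast
    ring
  have hs : Summable (fourierCoeff G) := by
    refine summable_of_ne_finset_zero (s := {0}) fun n hn => hcoef n (by simpa using hn)
  -- With only the zeroth coefficient left, the Fourier series is constant, and the value at the end
  -- point makes the constant zero.
  have hval : ∀ y : AddCircle (1 : ℝ), G y = fourierCoeff G 0 := by
    intro y
    have h := has_pointwise_sum_fourier_series_of_summable hs y
    have h' := hasSum_single (f := fun i => fourierCoeff G i • fourier i y) 0
      (fun n hn => by rw [hcoef n hn, zero_smul])
    rw [fourier_zero, smul_eq_mul, mul_one] at h'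
    exact h.unique h'
  have hG' : ∀ y ∈ Set.Ico (-(1 / 2) : ℝ) (1 / 2), G (y : AddCircle (1 : ℝ)) = g y := by
    intro y hy
    refine AddCircle.liftIco_coe_apply ?_
    rwa [show (-(1 / 2) + 1 : ℝ) = 1 / 2 by norm_num]
  rw [← hG' x hx, hval, ← hval ((-(1 / 2) : ℝ) : AddCircle (1 : ℝ)),
    hG' _ ⟨le_rfl, by norm_num⟩, h0]

open scoped FourierTransform in
/-- An integrable function of exponential type `π` that vanishes at the nonzero integers is
zero. -/
lemma IsExpTypeAtMost.eq_zero_of_intCast {J : ℂ → ℂ} (hJ : IsExpTypeAtMost Real.pi J)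
    (hi : Integrable fun x : ℝ => J x) (hz : ∀ n : ℤ, n ≠ 0 → J n = 0) : J = 0 := by
  set j : ℝ → ℂ := fun x => J x with hj
  have hjc : Continuous j := hJ.entire.continuous.comp Complex.continuous_ofReal
  have hπ := Real.pi_pos
  have hFc : Continuous (𝓕 j) :=
    VectorFourier.fourierIntegral_continuous Real.continuous_fourierChar
      (by exact continuous_inner) hi
  have hF0 : ∀ ξ : ℝ, 1 / 2 ≤ |ξ| → 𝓕 j ξ = 0 := by
    intro ξ hξ
    rw [Real.fourier_real_eq_integral_exp_smul, ← hJ.integral_mul_exp_eq_zero hπ hi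
      (a := -2 * Real.pi * ξ) (by
        rw [abs_mul, abs_mul, abs_neg, abs_two, abs_of_pos hπ]
        nlinarith)]
    refine integral_congr_ae (Eventually.of_forall fun x => ?_)
    simp only [smul_eq_mul, hj]
    rw [mul_comm]
    push_cast
    ring_nf
  have hsupp : Function.support (𝓕 j) ⊆ Set.Ioc (-(1 / 2)) (1 / 2) := by
    intro ξ hξ
    by_contra hmem
    refine hξ (hF0 ξ ?_)
    by_contra hlt
    rw [not_le, abs_lt] at hlt
    exact hmem ⟨hlt.1, hlt.2.le⟩
  have hFi : Integrable (𝓕 j) := by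
    rw [← integrableOn_iff_integrable_of_support_subset hsupp]
    exact (hFc.integrableOn_Icc (a := -(1 / 2)) (b := 1 / 2)).mono_set Set.Ioc_subset_Icc_self
  -- The transform is continuous and supported in a single period, so inversion at an integer `n`
  -- identifies `J n` with one of its Fourier coefficients. The missing node `0` leaves only a
  -- constant, which vanishing at `±1/2` excludes.
  have hinv := Continuous.fourierInv_fourier_eq hjc hi hFi
  have hF : ∀ ξ, 𝓕 j ξ = 0 := by
    intro ξ
    rcases le_or_gt (1 / 2) |ξ| with h | h
    · exact hF0 ξ h
    · rw [abs_lt] at h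
      refine eq_zero_of_fourier_coeff_eq_zero hFc (hF0 _ (by norm_num))
        (hF0 _ (by norm_num)) (fun n hn => ?_) ⟨h.1.le, h.2⟩
      have h1 := congrFun hinv (n : ℝ)
      rw [Real.fourierInv_eq', show j (n : ℝ) = 0 by simpa [hj] using hz n hn] at h1
      rw [← h1, intervalIntegral.integral_eq_integral_of_support_subset]
      · refine integral_congr_ae (Eventually.of_forall fun x => ?_)
        simp only [smul_eq_mul]
        congr 3
        simp
        ring
      · intro x hx
        exact hsupp (right_ne_zero_of_mul hx)
  have hj0 : ∀ x : ℝ, J x = 0 := by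
    intro x
    have h1 := congrFun hinv x
    rw [Real.fourierInv_eq'] at h1
    simp only [hF, smul_zero, integral_zero] at h1
    exact h1.symm
  have han : AnalyticOnNhd ℂ J Set.univ :=
    (hJ.entire.differentiableOn).analyticOnNhd isOpen_univ
  refine han.eq_of_frequently_eq (g := 0) (z₀ := 0) analyticOnNhd_const ?_
  have ht : Tendsto (fun x : ℝ => (x : ℂ)) (𝓝[≠] 0) (𝓝[≠] 0) := by
    refine tendsto_nhdsWithin_iff.2 ⟨?_, ?_⟩
    · simpa using (Complex.continuous_ofReal.tendsto 0).mono_left nhdsWithin_le_nhds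
    · exact eventually_nhdsWithin_of_forall fun x hx => by simpa using hx
  exact ht.frequently (Frequently.of_forall fun x => by simpa using hj0 x)

/-! ### Integrability of the interpolant. -/

lemma abs_sinc_le_two_div (u : ℝ) : |Real.sinc (Real.pi * u)| ≤ 2 / (1 + |u|) := by
  rw [le_div_iff₀ (by positivity)]
  have h1 := Real.abs_sinc_le_one (Real.pi * u)
  have h2 : |Real.sinc (Real.pi * u)| * |u| ≤ 1 := by
    by_cases hu : u = 0
    · simp [hu]
    · have hπ := Real.pi_gt_three
      have hu' : 0 < |u| := abs_pos.2 hu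
      rw [Real.sinc_of_ne_zero (mul_ne_zero Real.pi_ne_zero hu), abs_div, abs_mul,
        abs_of_pos Real.pi_pos, div_mul_eq_mul_div, div_le_one (by positivity)]
      have := Real.abs_sin_le_one (Real.pi * u)
      nlinarith
  nlinarith [abs_nonneg u]

/-- The decay `1/x²` comes from the factor `m/x` of `sinc_sub_sinc_eq` and from `|x| ≤ 2m(1 +
|x-m|)`. The cost is quadratic in `m`, which the Gaussian weights absorb. -/
lemma abs_interpolant_term_le (n : ℕ) (x : ℝ) :
    |Real.sinc (Real.pi * (x - (n + 1))) - (-1) ^ (n + 1) * Real.sinc (Real.pi * x)| ≤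
      8 * ((n : ℝ) + 1) ^ 2 * (1 + x ^ 2)⁻¹ := by
  have hn : (1 : ℝ) ≤ n + 1 := by linarith [(Nat.cast_nonneg n : (0 : ℝ) ≤ n)]
  set m : ℝ := n + 1 with hm
  rw [← div_eq_mul_inv, le_div_iff₀ (by positivity)]
  rcases le_or_gt |x| 1 with h | h
  · have h1 := Real.abs_sinc_le_one (Real.pi * (x - m))
    have h2 := Real.abs_sinc_le_one (Real.pi * x)
    have h3 : |Real.sinc (Real.pi * (x - m)) - (-1) ^ (n + 1) * Real.sinc (Real.pi * x)| ≤ 2 := by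
      refine (abs_sub _ _).trans ?_
      rw [abs_mul, abs_pow, abs_neg, abs_one, one_pow, one_mul]
      linarith
    have h4 : x ^ 2 ≤ 1 := by rw [← sq_abs]; exact pow_le_one₀ (abs_nonneg _) h
    calc _ ≤ 2 * 2 := mul_le_mul h3 (by linarith) (by positivity) (by norm_num)
      _ ≤ _ := by nlinarith
  · have hx0 : x ≠ 0 := by rintro rfl; simp at h; linarith
    have h0 : 0 < |x| := by linarith
    rw [sinc_sub_sinc_eq hx0, ← hm, abs_mul, abs_div, abs_of_pos (by linarith : 0 < m)]
    have h1 := abs_sinc_le_two_div (x - m)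
    have h2 : |x| ≤ 2 * m * (1 + |x - m|) := by
      have : |x| ≤ |x - m| + m := by
        calc |x| = |x - m + m| := by ring_nf
          _ ≤ |x - m| + |m| := abs_add_le _ _
          _ = _ := by rw [abs_of_pos (by linarith : 0 < m)]
      nlinarith [abs_nonneg (x - m)]
    have h3 : 1 + x ^ 2 ≤ 2 * |x| ^ 2 := by rw [sq_abs]; nlinarith [sq_abs x]
    have h4 : |Real.sinc (Real.pi * (x - m))| ≤ 4 * m / |x| := by
      refine h1.trans ?_
      rw [div_le_div_iff₀ (by positivity) h0]
      nlinarith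
    calc m / |x| * |Real.sinc (Real.pi * (x - m))| * (1 + x ^ 2) ≤
        m / |x| * (4 * m / |x|) * (2 * |x| ^ 2) := by gcongr
      _ = _ := by field_simp; ring

lemma integrable_interpolant {lam : ℝ} (hlam : 0 < lam) :
    Integrable fun x : ℝ => interpolant lam x := by
  have hs := (summable_gaussian_succ hlam 2)
  refine ((integrable_inv_one_add_sq).const_mul (8 * ∑' n : ℕ,
    ((n : ℝ) + 1) ^ 2 * Real.exp (-Real.pi * lam * (n + 1) ^ 2))).mono' ?_ ?_
  · exact ((isExpTypeAtMost_interpolant hlam).entire.continuous.comp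
      Complex.continuous_ofReal).aestronglyMeasurable
  · refine Eventually.of_forall fun x => ?_
    rw [interpolant_ofReal hlam, Complex.norm_real, mul_right_comm, ← tsum_mul_left]
    refine tsum_of_norm_bounded (hs.mul_left (8 * (1 + x ^ 2)⁻¹)).hasSum fun n => ?_
    rw [norm_mul, Real.norm_eq_abs, Real.abs_exp, Real.norm_eq_abs]
    calc _ ≤ Real.exp (-Real.pi * lam * (n + 1) ^ 2) * (8 * ((n : ℝ) + 1) ^ 2 * (1 + x ^ 2)⁻¹) :=
          mul_le_mul_of_nonneg_left (abs_interpolant_term_le n x) (Real.exp_pos _).le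
      _ = _ := by ring

lemma IsExpTypeAtMost.sub {σ : ℝ} {K L : ℂ → ℂ} (hK : IsExpTypeAtMost σ K)
    (hL : IsExpTypeAtMost σ L) : IsExpTypeAtMost σ (K - L) := by
  refine ⟨hK.entire.sub hL.entire, fun ε hε => ?_⟩
  obtain ⟨C, hC, h⟩ := hK.growth ε hε
  obtain ⟨D, hD, h'⟩ := hL.growth ε hε
  refine ⟨C + D, by positivity, fun z => ?_⟩
  rw [add_mul]
  exact (norm_sub_le _ _).trans (add_le_add (h z) (h' z))

/-! ### The duality identity and the case of equality. -/

lemma continuousAt_truncGaussian (lam : ℝ) {x : ℝ} (hx : x ≠ 0) :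
    ContinuousAt (truncGaussian lam) x := by
  rcases lt_or_gt_of_ne hx with h | h
  · refine (continuousAt_const (y := (0 : ℝ))).congr ?_
    filter_upwards [Iio_mem_nhds h] with y hy using (truncGaussian_of_neg lam hy).symm
  · refine ContinuousAt.congr (f := fun x => Real.exp (-Real.pi * lam * x ^ 2)) (by fun_prop) ?_
    filter_upwards [Ioi_mem_nhds h] with y hy using (truncGaussian_of_pos lam hy).symm

lemma abs_sign_le_one (x : ℝ) : |Real.sign x| ≤ 1 := by
  rcases Real.sign_apply_eq x with h | h | h <;> simp [h]

lemma sign_mul_eq_abs {s t : ℝ} (hs : s ≠ 0) (h : 0 ≤ s * t) : Real.sign s * t = |t| := by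
  rcases lt_or_gt_of_ne hs with h' | h'
  · rw [Real.sign_of_neg h', abs_of_nonpos (nonpos_of_mul_nonneg_right h h')]
    ring
  · rw [Real.sign_of_pos h', abs_of_nonneg (nonneg_of_mul_nonneg_right h h')]
    ring

lemma measurable_sign : Measurable Real.sign := by
  unfold Real.sign
  exact Measurable.ite measurableSet_Iio measurable_const
    (Measurable.ite measurableSet_Ioi measurable_const measurable_const)

lemma integrable_sign_sin_smul {E : Type*} [NormedAddCommGroup E] [NormedSpace ℝ E]
    {f : ℝ → E} (hf : Integrable f) :
    Integrable fun x => Real.sign (Real.sin (Real.pi * x)) • f x :=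
  hf.bdd_smul 1 (measurable_sign.comp (by fun_prop)).aestronglyMeasurable
    (Eventually.of_forall fun x => abs_sign_le_one _)

lemma integral_sign_sin_mul_sub {lam : ℝ} (hlam : 0 < lam) {K : ℂ → ℂ}
    (hK : IsExpTypeAtMost Real.pi K) (hi : Integrable fun x : ℝ => K x) :
    ∫ x : ℝ, Real.sign (Real.sin (Real.pi * x)) * ((truncGaussian lam x : ℂ) - K x).re =
      minimalValue lam := by
  have hre : Integrable fun x : ℝ => (K x).re := hi.re
  have h1 : ∫ x : ℝ, Real.sign (Real.sin (Real.pi * x)) * (K x).re = 0 := by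
    have h := congrArg Complex.re (hK.integral_sign_sin_smul_eq_zero hi)
    rw [Complex.zero_re] at h
    rw [← h]
    have := integral_re (integrable_sign_sin_smul hi)
    simpa using this
  have h2 := integral_sign_sin_mul_truncGaussian hlam
  simp only [Complex.sub_re, Complex.ofReal_re, mul_sub]
  have hg' : Integrable fun x : ℝ => Real.sign (Real.sin (Real.pi * x)) * truncGaussian lam x :=
    integrable_sign_sin_smul (integrable_truncGaussian hlam)
  have hk' : Integrable fun x : ℝ => Real.sign (Real.sin (Real.pi * x)) * (K x).re :=
    integrable_sign_sin_smul hre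
  rw [integral_sub hg' hk', h1, h2, sub_zero]

/-- In the case of equality the approximation interpolates at the nonzero integers. -/
lemma eq_truncGaussian_of_norm_eq {lam : ℝ} {K : ℂ → ℂ} (hK : Continuous K)
    (h : ∀ᵐ x : ℝ, ‖(truncGaussian lam x : ℂ) - K x‖ =
      Real.sign (Real.sin (Real.pi * x)) * ((truncGaussian lam x : ℂ) - K x).re)
    {n : ℤ} (hn : n ≠ 0) : K n = (truncGaussian lam n : ℂ) := by
  set D : ℝ → ℂ := fun x => (truncGaussian lam x : ℂ) - K x with hD
  have hDc : ∀ x, x ≠ 0 → ContinuousAt D x := fun x hx =>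
    (Complex.continuous_ofReal.continuousAt.comp (continuousAt_truncGaussian lam hx)).sub
      (by fun_prop)
  -- Multiplying by `|sin πx|` removes the discontinuous sign, so an equality almost everywhere
  -- between functions continuous off `0` holds at every `x ≠ 0`.
  have heq : Set.EqOn (fun x => |Real.sin (Real.pi * x)| * ‖D x‖)
      (fun x => Real.sin (Real.pi * x) * (D x).re) {0}ᶜ := by
    refine Measure.eqOn_open_of_ae_eq (μ := volume) (ae_restrict_of_ae ?_)
      isOpen_compl_singleton ?_ ?_
    · filter_upwards [h] with x hx
      rw [hx, ← mul_assoc]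
      congr 1
      rcases lt_trichotomy (Real.sin (Real.pi * x)) 0 with h' | h' | h'
      · rw [Real.sign_of_neg h', abs_of_neg h']; ring
      · rw [h']; simp
      · rw [Real.sign_of_pos h', abs_of_pos h']; ring
    · intro x hx
      have := hDc x hx
      exact ContinuousAt.continuousWithinAt (by fun_prop)
    · intro x hx
      have := hDc x hx
      exact (ContinuousAt.mul (by fun_prop)
        (Complex.continuous_re.continuousAt.comp this)).continuousWithinAt
  have hn0 : (n : ℝ) ≠ 0 := by exact_mod_cast hn
  have hsinp : ∀ t : ℝ, Real.sin (Real.pi * (n + t)) =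
      ((n.negOnePow : ℤ) : ℝ) * Real.sin (Real.pi * t) := by
    intro t
    rw [mul_add, add_comm, mul_comm Real.pi (n : ℝ), Real.sin_add_int_mul_pi,
      Int.cast_negOnePow]
  have hunit : ((n.negOnePow : ℤ) : ℝ) = 1 ∨ ((n.negOnePow : ℤ) : ℝ) = -1 := by
    rcases Int.even_or_odd n with h | h
    · left; rw [Int.negOnePow_even _ h]; simp
    · right; rw [Int.negOnePow_odd _ h]; simp
  -- Since `sin πx` changes sign at `n`, the limits from the right (`δ = 1`) and the left (`δ = -1`)
  -- give `‖D n‖ = ±Re (D n)` with opposite signs, so `D n = 0`.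
  have hside : ∀ δ : ℝ, (δ = 1 ∨ δ = -1) →
      ‖D n‖ = δ * (n.negOnePow : ℤ) * (D n).re := by
    intro δ hδ
    have hlim : Tendsto (fun t : ℝ => (n : ℝ) + δ * t) (𝓝[>] 0) (𝓝 n) := by
      have : Continuous fun t : ℝ => (n : ℝ) + δ * t := by fun_prop
      simpa using (this.tendsto 0).mono_left nhdsWithin_le_nhds
    have hl := (hDc n hn0).tendsto.comp hlim
    refine tendsto_nhds_unique (hl.norm) (Tendsto.congr' ?_
      (((Complex.continuous_re.tendsto _).comp hl).const_mul (δ * (n.negOnePow : ℤ))))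
    filter_upwards [Ioo_mem_nhdsGT (zero_lt_one' ℝ)] with t ht
    have hne : (n : ℝ) + δ * t ∈ ({0}ᶜ : Set ℝ) := by
      intro h0
      have hint : (n : ℝ) = -(δ * t) := by
        have : (n : ℝ) + δ * t = 0 := h0
        linarith
      have habs : |(n : ℝ)| < 1 := by
        rw [hint, abs_neg, abs_mul, abs_of_pos ht.1]
        rcases hδ with rfl | rfl <;> simp [ht.2]
      have : |n| < 1 := by exact_mod_cast habs
      exact hn (Int.abs_lt_one_iff.1 this)
    have hE := heq hne
    simp only [hsinp] at hE
    have hst : 0 < Real.sin (Real.pi * t) :=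
      Real.sin_pos_of_pos_of_lt_pi (mul_pos Real.pi_pos ht.1)
        (by nlinarith [Real.pi_pos, ht.2])
    have hsd : Real.sin (Real.pi * (δ * t)) = δ * Real.sin (Real.pi * t) := by
      rcases hδ with rfl | rfl
      · simp
      · rw [neg_one_mul, mul_neg, Real.sin_neg]; ring
    have hab : |((n.negOnePow : ℤ) : ℝ) * (δ * Real.sin (Real.pi * t))| =
        Real.sin (Real.pi * t) := by
      rw [abs_mul, abs_mul, abs_of_pos hst]
      rcases hδ with rfl | rfl <;> rcases hunit with h | h <;> rw [h] <;> simp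
    rw [hsd, hab] at hE
    refine mul_left_cancel₀ hst.ne' ?_
    simp only [Function.comp_apply]
    rw [hE]
    ring
  have h1 := hside 1 (Or.inl rfl)
  have h2 := hside (-1) (Or.inr rfl)
  have h0 : ‖D n‖ = 0 := by linarith
  rw [norm_eq_zero, hD] at h0
  have := sub_eq_zero.1 h0
  simpa using this.symm

end

/-! ### Assembly of the theorem. -/

theorem theorem1 (lam : ℝ) (hlam : 0 < lam) :
    -- `K⁺` is an entire function of exponential type at most `π`, extends the series,
    -- and interpolates `G⁺` at the nonzero integers
    IsExpTypeAtMost Real.pi (interpolant lam) ∧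
    (∀ z : ℂ, (∀ n : ℕ, z ≠ n) → interpolant lam z = interpolationSeries lam z) ∧
    (∀ n : ℤ, n ≠ 0 → interpolant lam n = (truncGaussian lam n : ℂ)) ∧
    -- the sign inequality; `K⁺` is real on the real line
    (∀ x : ℝ, (interpolant lam x).im = 0 ∧
      0 ≤ Real.sin (Real.pi * x) * (truncGaussian lam x - (interpolant lam x).re)) ∧
    -- the integral in the bound converges
    IntervalIntegrable (fun y : ℝ => thetaOne 0 (thetaPoint lam y)) volume 0 1 ∧
    -- the lower bound and the case of equality; the left integral may be infinite
    (∀ K : ℂ → ℂ, IsExpTypeAtMost Real.pi K →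
      ENNReal.ofReal (minimalValue lam) ≤ ∫⁻ x : ℝ, ‖(truncGaussian lam x : ℂ) - K x‖ₑ ∧
      (∫⁻ x : ℝ, ‖(truncGaussian lam x : ℂ) - K x‖ₑ = ENNReal.ofReal (minimalValue lam) ↔
        K = interpolant lam)) := by
  have hGi : Integrable fun x : ℝ => (truncGaussian lam x : ℂ) :=
    (integrable_truncGaussian hlam).ofReal
  refine ⟨isExpTypeAtMost_interpolant hlam, fun z hz => ?_, fun n hn => interpolant_intCast hlam hn,
    fun x => ⟨interpolant_im hlam x, sin_mul_sub_interpolant_nonneg hlam x⟩,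
    intervalIntegrable_thetaOne hlam, fun K hK => ?_⟩
  · rw [interpolant_eq hlam, interpolationSeries_eq hz]
  have hKm : AEStronglyMeasurable (fun x : ℝ => K x) :=
    (hK.entire.continuous.comp Complex.continuous_ofReal).aestronglyMeasurable
  by_cases hi : Integrable fun x : ℝ => K x
  swap
  -- `G⁺` is integrable, so a finite distance to `K` would make `K` integrable.
  · have htop : ∫⁻ x : ℝ, ‖(truncGaussian lam x : ℂ) - K x‖ₑ = ⊤ := by
      by_contra hne
      have hD : Integrable fun x : ℝ => (truncGaussian lam x : ℂ) - K x :=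
        ⟨hGi.1.sub hKm, lt_top_iff_ne_top.2 hne⟩
      refine hi ((hGi.sub hD).congr (Eventually.of_forall fun x => ?_))
      simp
    rw [htop]
    refine ⟨le_top, fun h => absurd h.symm ENNReal.ofReal_ne_top, ?_⟩
    rintro rfl
    exact absurd (integrable_interpolant hlam) hi
  have hD : Integrable fun x : ℝ => (truncGaussian lam x : ℂ) - K x := hGi.sub hi
  have hmin := integral_sign_sin_mul_sub hlam hK hi
  have hsD : Integrable fun x : ℝ => Real.sign (Real.sin (Real.pi * x)) *
      ((truncGaussian lam x : ℂ) - K x).re := integrable_sign_sin_smul hD.re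
  have hpt : ∀ x : ℝ, Real.sign (Real.sin (Real.pi * x)) * ((truncGaussian lam x : ℂ) - K x).re ≤
      ‖(truncGaussian lam x : ℂ) - K x‖ := by
    intro x
    refine (le_abs_self _).trans ?_
    rw [abs_mul]
    exact (mul_le_of_le_one_left (abs_nonneg _) (abs_sign_le_one _)).trans
      (Complex.abs_re_le_norm _)
  have hle : minimalValue lam ≤ ∫ x : ℝ, ‖(truncGaussian lam x : ℂ) - K x‖ := by
    rw [← hmin]
    exact integral_mono hsD hD.norm hpt
  have hnn : 0 ≤ minimalValue lam := by
    rw [minimalValue_eq_tsum hlam]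
    have : 0 ≤ ∑' k : ℕ, thetaTermIntegral (Real.pi * lam⁻¹ * (k + 1 / 2) ^ 2) :=
      tsum_nonneg fun k => thetaTermIntegral_nonneg _
    positivity
  rw [← ofReal_integral_norm_eq_lintegral_enorm hD]
  refine ⟨ENNReal.ofReal_le_ofReal hle, fun h => ?_, ?_⟩
  · have heq : ∫ x : ℝ, ‖(truncGaussian lam x : ℂ) - K x‖ = minimalValue lam :=
      (ENNReal.ofReal_eq_ofReal_iff (integral_nonneg fun _ => norm_nonneg _) hnn).1 h
    -- The pointwise bound `hpt` has integral gap zero, so it is an equality almost everywhere.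
    have hzero : ∫ x : ℝ, (‖(truncGaussian lam x : ℂ) - K x‖ -
        Real.sign (Real.sin (Real.pi * x)) * ((truncGaussian lam x : ℂ) - K x).re) = 0 := by
      rw [integral_sub hD.norm hsD, heq, hmin, sub_self]
    rw [integral_eq_zero_iff_of_nonneg (fun x => sub_nonneg.2 (hpt x)) (hD.norm.sub hsD)] at hzero
    have hae : ∀ᵐ x : ℝ, ‖(truncGaussian lam x : ℂ) - K x‖ =
        Real.sign (Real.sin (Real.pi * x)) * ((truncGaussian lam x : ℂ) - K x).re := by
      filter_upwards [hzero] with x hx using sub_eq_zero.1 hx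
    refine sub_eq_zero.1 ((hK.sub (isExpTypeAtMost_interpolant hlam)).eq_zero_of_intCast
      (hi.sub (integrable_interpolant hlam)) fun n hn => ?_)
    rw [Pi.sub_apply, eq_truncGaussian_of_norm_eq hK.entire.continuous hae hn,
      interpolant_intCast hlam hn, sub_self]
  · rintro rfl
    congr 1
    rw [← hmin]
    refine integral_congr_ae ?_
    filter_upwards [ae_sin_pi_mul_ne_zero] with x hx
    have him := interpolant_im hlam x
    have hreal : (truncGaussian lam x : ℂ) - interpolant lam x =
        ((truncGaussian lam x - (interpolant lam x).re : ℝ) : ℂ) := by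
      apply Complex.ext <;> simp [him]
    rw [hreal, Complex.norm_real, Complex.ofReal_re, Real.norm_eq_abs,
      sign_mul_eq_abs hx (sin_mul_sub_interpolant_nonneg hlam x)]
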